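/- Let $\mathbb D$ be the open unit disc, $\mathbb T$ the unit circle and $m$ the normalized Lebesgue measure on $\mathbb T$. For $0<p<\infty$ let $H^p$ be the space of functions $h$ analytic in $\mathbb D$ with $\|h\|_{H^p}^p=\sup_{0<r<1}\int_{\mathbb T}|h(r\zeta)|^p\,dm(\zeta)<\infty$, and let $H^\infty$ be the space of bounded analytic functions on $\mathbb D$ with $\|h\|_{H^\infty}=\sup_{z\in\mathbb D}|h(z)|$. On $\mathbb T$ the functions are understood through their radial boundary values, which exist almost everywhere. For $g\in H^\infty$ put $$\Lambda(g)=\operatorname*{ess\,sup}_{\eta\in\mathbb T}\int_{\mathbb T}\frac{|g(\zeta)-g(\eta)|}{|\zeta-\eta|}\,dm(\zeta),\qquad \|g\|_{\mathfrak N}=\|g\|_{H^\infty}+\Lambda(g),$$ let $\mathfrak N$ be the class of all $g\in H^\infty$ with $\Lambda(g)<\infty$, and let $T_g$ be the Toeplitz operator $$(T_gh)(z)=\int_{\mathbb T}\frac{\overline{g(\zeta)}\,h(\zeta)}{1-\overline\zeta z}\,dm(\zeta),\qquad z\in\mathbb D,$$ with $\|T_g\|_{H^p}$ its operator norm on $H^p$.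 **Theorem 2.** Let $\alpha=(\alpha_n)_{n\ge0}$ be a (weakly) decreasing sequence of positive numbers with $\alpha_n-2\alpha_{n+1}+\alpha_{n+2}\ge0$ for all $n\ge0$ and $\|\alpha\|:=\sum_{n\ge0}\frac{\alpha_n}{n+1}<\infty$. For $f\in H^\infty$ with Taylor coefficients $\hat f(n)$ at $0$, let $(f*\alpha)(z)=\sum_{n\ge0}\hat f(n)\,\alpha_n z^n$, $z\in\mathbb D$. Then for every $f\in H^\infty$ the function $f*\alpha$ belongs to $\mathfrak N$, the Toeplitz operator $T_{f*\alpha}$ is a bounded linear operator from $H^p$ to itself for $p=1$ and for $p=\infty$, and $$\|T_{f*\alpha}\|_{H^p}\le\|f*\alpha\|_{\mathfrak N}\le12\,\|f\|_{H^\infty}\,\|\alpha\|,\qquad p=1,\infty.$$ -/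

import Mathlib

open MeasureTheory Set Filter Topology
open scoped ENNReal ComplexConjugate

noncomputable section

namespace HardyToeplitz

/-- The open unit disc of the complex plane. -/
def disc : Set ℂ := Metric.ball 0 1

/-- The normalized Lebesgue (arc length) measure on the unit circle, as a measure on the complex
plane: the image of `dθ / 2π` on `(0, 2π]` under `θ ↦ exp (iθ)`. -/
def arcMeasure : Measure ℂ :=
  ((ENNReal.ofReal (2 * Real.pi))⁻¹ • volume.restrict (Ioc 0 (2 * Real.pi))).map (circleMap 0 1)

/-- The Hardy norm, for `0 < p ≤ ∞`, with values in `[0, ∞]`. Functions are given on the whole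
plane, but only their values in the open unit disc matter. -/
def hardyNorm (p : ℝ≥0∞) (f : ℂ → ℂ) : ℝ≥0∞ :=
  if p = ∞ then ⨆ z ∈ disc, ‖f z‖ₑ
  else (⨆ r ∈ Ioo (0 : ℝ) 1, ∫⁻ ζ, ‖f (r * ζ)‖ₑ ^ p.toReal ∂arcMeasure) ^ (1 / p.toReal)

/-- The Hardy space `H^p`, for `0 < p ≤ ∞`: the functions that are analytic in the unit disc and
have a finite Hardy norm. -/
def hardySpace (p : ℝ≥0∞) : Set (ℂ → ℂ) :=
  {f | DifferentiableOn ℂ f disc ∧ hardyNorm p f < ∞}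

/-- The boundary function, for `ζ` on the unit circle: the radial limit of `f`, at every point where it
exists (almost everywhere for a function of a Hardy space). -/
def boundaryValue (f : ℂ → ℂ) (ζ : ℂ) : ℂ :=
  limUnder (𝓝[<] (1 : ℝ)) (fun r : ℝ => f (r * ζ))

/-- The Toeplitz operator with the conjugate of `f` as its symbol:
`(T_f h)(z) = ∫ conj (f ζ) * h ζ / (1 - conj ζ * z) dm(ζ)`. -/
def toeplitz (f h : ℂ → ℂ) (z : ℂ) : ℂ :=
  ∫ ζ, conj (boundaryValue f ζ) * boundaryValue h ζ / (1 - conj ζ * z) ∂arcMeasure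

/-- The operator norm of `T` on `H^p`: the supremum of `‖T h‖` over the unit ball of `H^p`. -/
def opNorm (p : ℝ≥0∞) (T : (ℂ → ℂ) → (ℂ → ℂ)) : ℝ≥0∞ :=
  ⨆ h ∈ {h | h ∈ hardySpace p ∧ hardyNorm p h ≤ 1}, hardyNorm p (T h)

/-- `T` is a bounded linear operator from `H^p` to itself, the elements of `H^p` being regarded as
functions on the unit disc. -/
structure IsBoundedOperator (p : ℝ≥0∞) (T : (ℂ → ℂ) → (ℂ → ℂ)) : Prop where
  mapsTo : MapsTo T (hardySpace p) (hardySpace p)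
  map_add : ∀ g ∈ hardySpace p, ∀ h ∈ hardySpace p, EqOn (T (g + h)) (T g + T h) disc
  map_smul : ∀ c : ℂ, ∀ h ∈ hardySpace p, EqOn (T (c • h)) (c • T h) disc
  opNorm_lt_top : opNorm p T < ∞

/-- The Toeplitz operator `T_f` is bounded on `H^p`: the integrals that define it converge
absolutely for all `h` in `H^p`, and it is a bounded linear operator from `H^p` to itself. -/
def ToeplitzBounded (p : ℝ≥0∞) (f : ℂ → ℂ) : Prop :=
  (∀ h ∈ hardySpace p, ∀ z ∈ disc, Integrable (fun ζ =>
      conj (boundaryValue f ζ) * boundaryValue h ζ / (1 - conj ζ * z)) arcMeasure) ∧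
    IsBoundedOperator p (toeplitz f)

/-- `Λ(f)`, the essential supremum over `η` on the unit circle of
`∫ |f ζ - f η| / |ζ - η| dm(ζ)`. -/
def lam (f : ℂ → ℂ) : ℝ≥0∞ :=
  essSup (fun η =>
    ∫⁻ ζ, ‖boundaryValue f ζ - boundaryValue f η‖ₑ / ‖ζ - η‖ₑ ∂arcMeasure)
    arcMeasure

/-- The class `𝔑` of all `f` in `H^∞` with `Λ(f) < ∞`. -/
def classN : Set (ℂ → ℂ) := {f | f ∈ hardySpace ∞ ∧ lam f < ∞}

/-- The norm `‖f‖_∞ + Λ(f)` of the class `𝔑`. -/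
def normN (f : ℂ → ℂ) : ℝ≥0∞ := hardyNorm ∞ f + lam f

/-- The `n`-th Taylor coefficient of `f` at the origin. -/
def taylorCoeff (f : ℂ → ℂ) (n : ℕ) : ℂ := iteratedDeriv n f 0 / (n.factorial : ℂ)

/-- The function `f * α`, with the value `∑ f̂(n) α_n z^n` at the point `z`. -/
def coeffMul (f : ℂ → ℂ) (α : ℕ → ℝ) (z : ℂ) : ℂ := ∑' n : ℕ, taylorCoeff f n * (α n : ℂ) * z ^ n

end HardyToeplitz

end

noncomputable section

namespace HardyToeplitz

/-! The bound for the operator and the bound for the multiplier are independent.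

Operator. Let g be in 𝔑. In the integral for (T_g h)(ρη), |η| = 1, split conj g(ζ) into conj g(η)
and conj (g(ζ) - g(η)). By Cauchy's formula the first part gives conj g(η) h(ρη). Since |1 - conj ζ
ρη| ≥ √ρ |ζ - η|, the second is at most ρ^(-1/2) ∫ |g(ζ) - g(η)| / |ζ - η| · |h(ζ)| dm(ζ); this is
`enorm_toeplitz_le`. For p = ∞ take |h| out of the integral; for p = 1 integrate in η and use
Tonelli and the symmetry of the difference quotient. Letting ρ → 1 gives the bound by ‖g‖_∞ + Λ(g).

This needs radial limits and Cauchy's formula for all of H¹. They come from a factorization h = ab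
with a, b in H² (`exists_factorization`): the Taylor sums of a and b converge in L², so their
products converge in L¹, and Cauchy's formula for polynomials passes to the limit. Radial limits of
a and b follow from Fatou's theorem for Poisson integrals. The factorization itself is explicit for
polynomials, root by root, and is carried to h by compactness of the coefficients.

Multiplier. A convex null sequence satisfies α_n = ∑ (k + 1 - n)₊ c_k with second differences c_k ≥
0, so f * α = ∑ c_k F_k, where F_k is the unnormalized Fejér sum of f. Positivity of the Fejér
kernel gives |F_k| ≤ (k + 1)‖f‖_∞. Hence the difference quotients of F_k are at most (k + 1)‖f‖_∞
min(k², 2/|ζ - η|), whose integral costs a factor 1 + 2 log k. Finally (k + 1)(2 + 2 log k) is at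
most 12 ∑_{n ≤ k} (k + 1 - n)/(n + 1) (`mul_log_le_sum`), and summing against c_k turns the right
side into 12 ∑ α_n/(n + 1). -/

/-! ### Normalized arc length on the circle. -/

theorem arcMeasure_eq_map (a : ℝ) :
    arcMeasure = ((ENNReal.ofReal (2 * Real.pi))⁻¹ •
      volume.restrict (Ioc a (a + 2 * Real.pi))).map (circleMap 0 1) := by
  have : Fact (0 < 2 * Real.pi) := ⟨Real.two_pi_pos⟩
  have hc : Continuous (fun x : AddCircle (2 * Real.pi) => (AddCircle.toCircle x : ℂ)) :=
    continuous_subtype_val.comp AddCircle.continuous_toCircle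
  have hcomp : circleMap 0 1 =
      (fun x : AddCircle (2 * Real.pi) => (AddCircle.toCircle x : ℂ)) ∘
        (fun t : ℝ => (t : AddCircle (2 * Real.pi))) := by
    ext t
    simp [circleMap, AddCircle.toCircle_apply_mk, Real.pi_ne_zero]
  have key : ∀ b : ℝ, (volume.restrict (Ioc b (b + 2 * Real.pi))).map (circleMap 0 1) =
      (volume : Measure (AddCircle (2 * Real.pi))).map
        (fun x : AddCircle (2 * Real.pi) => (AddCircle.toCircle x : ℂ)) := by
    intro b
    rw [hcomp, ← Measure.map_map hc.measurable AddCircle.measurable_mk',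
      (AddCircle.measurePreserving_mk (2 * Real.pi) b).map_eq]
  rw [arcMeasure, Measure.map_smul, Measure.map_smul, key a]
  congr 1
  simpa using key 0

instance : IsProbabilityMeasure arcMeasure := by
  refine ⟨?_⟩
  have h : (ENNReal.ofReal (2 * Real.pi)) ≠ 0 := by simp [Real.pi_pos]
  rw [arcMeasure, Measure.map_apply (continuous_circleMap 0 1).measurable MeasurableSet.univ]
  simp only [preimage_univ, Measure.smul_apply, Measure.restrict_apply_univ, Real.volume_Ioc,
    sub_zero, smul_eq_mul]
  exact ENNReal.inv_mul_cancel h ENNReal.ofReal_ne_top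

theorem ae_norm_eq_one : ∀ᵐ ζ ∂arcMeasure, ‖ζ‖ = 1 := by
  rw [arcMeasure, ae_map_iff (continuous_circleMap 0 1).measurable.aemeasurable
    (measurableSet_eq_fun measurable_norm measurable_const)]
  exact Eventually.of_forall fun θ => by simp

theorem ae_mem_sphere : ∀ᵐ ζ ∂arcMeasure, ζ ∈ Metric.sphere (0 : ℂ) 1 := by
  filter_upwards [ae_norm_eq_one] with ζ h using by simpa using h

theorem restrict_sphere : arcMeasure.restrict (Metric.sphere (0 : ℂ) 1) = arcMeasure :=
  Measure.restrict_eq_self_of_ae_mem ae_mem_sphere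

theorem integral_arcMeasure {E : Type*} [NormedAddCommGroup E] [NormedSpace ℝ E] {F : ℂ → E}
    (hF : AEStronglyMeasurable F arcMeasure) :
    ∫ ζ, F ζ ∂arcMeasure = Real.circleAverage F 0 1 := by
  rw [arcMeasure] at hF ⊢
  rw [integral_map (continuous_circleMap 0 1).measurable.aemeasurable hF,
    integral_smul_measure, Real.circleAverage_def,
    intervalIntegral.integral_of_le Real.two_pi_pos.le]
  simp [ENNReal.toReal_ofReal, Real.pi_pos.le]

theorem aestronglyMeasurable_of_continuousOn {E : Type*} [TopologicalSpace E]
    [TopologicalSpace.PseudoMetrizableSpace E] {F : ℂ → E}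
    (hF : ContinuousOn F (Metric.sphere (0 : ℂ) 1)) : AEStronglyMeasurable F arcMeasure := by
  rw [← restrict_sphere]
  exact hF.aestronglyMeasurable_of_isCompact (isCompact_sphere 0 1)
    Metric.isClosed_sphere.measurableSet

theorem memLp_of_continuousOn {E : Type*} [NormedAddCommGroup E] {F : ℂ → E}
    (hF : ContinuousOn F (Metric.sphere (0 : ℂ) 1)) (p : ℝ≥0∞) : MemLp F p arcMeasure := by
  obtain ⟨C, hC⟩ := (isCompact_sphere (0 : ℂ) 1).exists_bound_of_continuousOn hF
  exact MemLp.of_bound (aestronglyMeasurable_of_continuousOn hF) C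
    (by filter_upwards [ae_mem_sphere] with ζ h using hC ζ h)

theorem integrable_of_continuousOn {E : Type*} [NormedAddCommGroup E] {F : ℂ → E}
    (hF : ContinuousOn F (Metric.sphere (0 : ℂ) 1)) : Integrable F arcMeasure :=
  memLp_one_iff_integrable.1 (memLp_of_continuousOn hF 1)

theorem circleIntegrable_of_integrable {E : Type*} [NormedAddCommGroup E] {F : ℂ → E}
    (hF : Integrable F arcMeasure) : CircleIntegrable F 0 1 := by
  rw [CircleIntegrable, intervalIntegrable_iff, uIoc_of_le Real.two_pi_pos.le, IntegrableOn]
  rw [arcMeasure, integrable_map_measure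
    (by simpa [arcMeasure] using hF.aestronglyMeasurable)
    (continuous_circleMap 0 1).measurable.aemeasurable] at hF
  exact (integrable_smul_measure (ENNReal.inv_ne_zero.2 ENNReal.ofReal_ne_top)
    (by simp [Real.pi_pos])).1 hF

theorem norm_circleMap_sub (s t : ℝ) :
    ‖circleMap 0 1 s - circleMap 0 1 t‖ = 2 * |Real.sin ((s - t) / 2)| := by
  have h : circleMap 0 1 s - circleMap 0 1 t =
      Complex.exp (t * Complex.I) * (Complex.exp (Complex.I * ((s - t : ℝ) : ℂ)) - 1) := by
    simp only [circleMap, zero_add, Complex.ofReal_one, one_mul, mul_sub, mul_one,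
      ← Complex.exp_add]
    congr 2
    push_cast
    ring
  rw [h, norm_mul, Complex.norm_exp_ofReal_mul_I, one_mul, Complex.norm_exp_I_mul_ofReal_sub_one]
  simp

theorem arcMeasure_closedBall_le {η : ℂ} (hη : ‖η‖ = 1) (s : ℝ) :
    arcMeasure (Metric.closedBall η s) ≤ ENNReal.ofReal (s / 2) := by
  have hη' : circleMap 0 1 η.arg = η := by
    have := Complex.norm_mul_exp_arg_mul_I η
    simpa [circleMap, hη] using this
  set t := η.arg
  -- The period is centred at the argument of η, so that the ball pulls back into a single interval.
  rw [arcMeasure_eq_map (t - Real.pi),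
    Measure.map_apply (continuous_circleMap 0 1).measurable Metric.isClosed_closedBall.measurableSet,
    Measure.smul_apply, Measure.restrict_apply
      ((continuous_circleMap 0 1).measurable Metric.isClosed_closedBall.measurableSet)]
  have hsub : circleMap 0 1 ⁻¹' Metric.closedBall η s ∩ Ioc (t - Real.pi) (t - Real.pi + 2 * Real.pi)
      ⊆ Icc (t - Real.pi / 2 * s) (t + Real.pi / 2 * s) := by
    rintro θ ⟨h1, h2, h3⟩
    have h1' : ‖circleMap 0 1 θ - circleMap 0 1 t‖ ≤ s := by
      rw [hη']; simpa [dist_eq_norm] using h1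
    rw [norm_circleMap_sub] at h1'
    have hx : |(θ - t) / 2| ≤ Real.pi / 2 := by rw [abs_le]; constructor <;> linarith
    -- Jordan's inequality: a chord is at least 2/π times its arc, so the arc has length at most π s
    -- out of 2π.
    have h4 := Real.mul_abs_le_abs_sin hx
    have h5 : |θ - t| = 2 * |(θ - t) / 2| := by rw [abs_div]; simp; ring
    have h6 : |θ - t| ≤ Real.pi / 2 * s := by
      have : 2 / Real.pi * |(θ - t) / 2| ≤ s / 2 := by linarith
      rw [h5]
      have hp := Real.pi_pos
      calc 2 * |(θ - t) / 2| = Real.pi * (2 / Real.pi * |(θ - t) / 2|) := by field_simp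
        _ ≤ Real.pi * (s / 2) := by gcongr
        _ = _ := by ring
    rw [abs_le] at h6
    constructor <;> linarith
  calc _ ≤ (ENNReal.ofReal (2 * Real.pi))⁻¹ • volume (Icc (t - Real.pi / 2 * s) (t + Real.pi / 2 * s)) := by
        gcongr
    _ = _ := by
        rw [Real.volume_Icc, smul_eq_mul, mul_comm, ← div_eq_mul_inv,
          ← ENNReal.ofReal_div_of_pos Real.two_pi_pos]
        congr 1
        field_simp
        ring

/-! ### Poisson and Cauchy kernels, orthogonality of monomials. -/

theorem mem_disc {z : ℂ} : z ∈ disc ↔ ‖z‖ < 1 := by simp [disc]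

theorem isOpen_disc : IsOpen disc := Metric.isOpen_ball

theorem sub_ne_zero_of_norm {w ζ : ℂ} (hw : ‖w‖ < 1) (hζ : ‖ζ‖ = 1) : ζ - w ≠ 0 := by
  intro h
  rw [sub_eq_zero] at h
  rw [h] at hζ
  linarith

theorem one_sub_conj_mul {ζ : ℂ} (hζ : ‖ζ‖ = 1) (z : ℂ) : 1 - conj ζ * z = conj ζ * (ζ - z) := by
  rw [mul_sub, mul_comm (conj ζ) ζ, Complex.mul_conj']
  simp [hζ]

theorem norm_one_sub_conj_mul {ζ : ℂ} (hζ : ‖ζ‖ = 1) (z : ℂ) : ‖1 - conj ζ * z‖ = ‖ζ - z‖ := by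
  rw [one_sub_conj_mul hζ, norm_mul, RCLike.norm_conj, hζ, one_mul]

theorem one_sub_conj_mul_ne_zero {w ζ : ℂ} (hw : ‖w‖ < 1) (hζ : ‖ζ‖ = 1) :
    1 - conj ζ * w ≠ 0 := by
  rw [← norm_ne_zero_iff, norm_one_sub_conj_mul hζ, norm_ne_zero_iff]
  exact sub_ne_zero_of_norm hw hζ

theorem poissonKernel_zero_eq (w ζ : ℂ) :
    poissonKernel 0 w ζ = (‖ζ‖ ^ 2 - ‖w‖ ^ 2) / ‖ζ - w‖ ^ 2 := by
  simp [poissonKernel_def]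

theorem poissonKernel_nonneg {w ζ : ℂ} (hw : ‖w‖ < 1) (hζ : ‖ζ‖ = 1) :
    0 ≤ poissonKernel 0 w ζ := by
  rw [poissonKernel_zero_eq, hζ]
  have := norm_nonneg w
  have : 0 ≤ (1 : ℝ) ^ 2 - ‖w‖ ^ 2 := by nlinarith
  positivity

theorem continuousOn_poissonKernel {w : ℂ} (hw : ‖w‖ < 1) :
    ContinuousOn (poissonKernel 0 w) (Metric.sphere (0 : ℂ) 1) := by
  have : poissonKernel 0 w = fun ζ => (‖ζ‖ ^ 2 - ‖w‖ ^ 2) / ‖ζ - w‖ ^ 2 := by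
    ext ζ; exact poissonKernel_zero_eq w ζ
  rw [this]
  refine ContinuousOn.div (by fun_prop) (by fun_prop) fun ζ hζ => ?_
  have := sub_ne_zero_of_norm hw (by simpa using hζ : ‖ζ‖ = 1)
  positivity

theorem continuousOn_inv_one_sub_conj_mul {w : ℂ} (hw : ‖w‖ < 1) :
    ContinuousOn (fun ζ : ℂ => (1 - conj ζ * w)⁻¹) (Metric.sphere (0 : ℂ) 1) := by
  refine ContinuousOn.inv₀ (by fun_prop) fun ζ hζ => ?_
  exact one_sub_conj_mul_ne_zero hw (by simpa using hζ)

theorem continuousOn_sphere_of_diffContOnCl {u : ℂ → ℂ} (hu : DiffContOnCl ℂ u (Metric.ball 0 1)) :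
    ContinuousOn u (Metric.sphere (0 : ℂ) 1) :=
  hu.2.mono (Metric.sphere_subset_closedBall.trans_eq (closure_ball 0 one_ne_zero).symm)

theorem integral_poissonKernel_mul {u : ℂ → ℂ} (hu : DiffContOnCl ℂ u (Metric.ball 0 1)) {w : ℂ}
    (hw : ‖w‖ < 1) : ∫ ζ, (poissonKernel 0 w ζ : ℂ) * u ζ ∂arcMeasure = u w := by
  rw [integral_arcMeasure]
  · exact hu.circleAverage_poissonKernel_smul (by simpa using hw)
  · exact aestronglyMeasurable_of_continuousOn
      ((Complex.continuous_ofReal.comp_continuousOn (continuousOn_poissonKernel hw)).mul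
        (continuousOn_sphere_of_diffContOnCl hu))

theorem integral_cauchyKernel_mul {u : ℂ → ℂ} (hu : DiffContOnCl ℂ u (Metric.ball 0 1)) {w : ℂ}
    (hw : ‖w‖ < 1) : ∫ ζ, u ζ / (1 - conj ζ * w) ∂arcMeasure = u w := by
  rw [integral_arcMeasure]
  · rw [← DiffContOnCl.circleAverage_smul_div (c := 0) (R := 1) (f := u) (w := w) (by simpa using hu)
      (by simpa using hw)]
    refine Real.circleAverage_congr_sphere fun ζ hζ => ?_
    have h1 : ‖ζ‖ = 1 := by simpa using hζ
    have h2 := sub_ne_zero_of_norm hw h1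
    have h0 : ζ ≠ 0 := by rintro rfl; simp at h1
    have h3 : conj ζ = ζ⁻¹ := by
      rw [Complex.inv_def, Complex.normSq_eq_norm_sq, h1]; simp
    simp only [h3, sub_zero, smul_eq_mul]
    field_simp
  · exact aestronglyMeasurable_of_continuousOn
      ((continuousOn_sphere_of_diffContOnCl hu).mul (continuousOn_inv_one_sub_conj_mul hw))

theorem lintegral_poissonKernel {w : ℂ} (hw : ‖w‖ < 1) :
    ∫⁻ ζ, ENNReal.ofReal (poissonKernel 0 w ζ) ∂arcMeasure = 1 := by
  rw [← ofReal_integral_eq_lintegral_ofReal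
    (integrable_of_continuousOn (continuousOn_poissonKernel hw))]
  · have h := integral_poissonKernel_mul (u := fun _ => 1) diffContOnCl_const hw
    simp only [mul_one] at h
    rw [integral_complex_ofReal] at h
    rw [Complex.ofReal_eq_one.1 h, ENNReal.ofReal_one]
  · filter_upwards [ae_norm_eq_one] with ζ hζ using poissonKernel_nonneg hw hζ

theorem diffContOnCl_dilation {u : ℂ → ℂ} (hu : DifferentiableOn ℂ u disc) {ρ : ℝ}
    (hρ : ρ ∈ Ioo (0 : ℝ) 1) : DiffContOnCl ℂ (fun z => u (ρ * z)) (Metric.ball 0 1) := by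
  refine DifferentiableOn.diffContOnCl ?_
  rw [closure_ball _ one_ne_zero]
  refine hu.comp (by fun_prop) fun z hz => ?_
  have h : ‖z‖ ≤ 1 := by simpa using hz
  rw [mem_disc, norm_mul, Complex.norm_real, Real.norm_of_nonneg hρ.1.le]
  nlinarith [hρ.1, hρ.2]

/-- Subharmonicity of |u|. The dilation by ρ makes the function continuous up to the circle, where
the Poisson formula applies. -/
theorem enorm_le_lintegral_poissonKernel {u : ℂ → ℂ} (hu : DifferentiableOn ℂ u disc) {ρ : ℝ}
    (hρ : ρ ∈ Ioo (0 : ℝ) 1) {w : ℂ} (hw : ‖w‖ < 1) :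
    ‖u (ρ * w)‖ₑ ≤ ∫⁻ ζ, ENNReal.ofReal (poissonKernel 0 w ζ) * ‖u (ρ * ζ)‖ₑ ∂arcMeasure := by
  rw [← integral_poissonKernel_mul (diffContOnCl_dilation hu hρ) hw]
  refine (enorm_integral_le_lintegral_enorm _).trans (lintegral_mono_ae ?_)
  filter_upwards [ae_norm_eq_one] with ζ hζ
  rw [enorm_mul]
  refine mul_le_mul_left (le_of_eq ?_) _
  rw [← ofReal_norm, Complex.norm_real, Real.norm_of_nonneg (poissonKernel_nonneg hw hζ)]

theorem conj_pow_mul_pow {ζ : ℂ} (hζ : ‖ζ‖ = 1) (n : ℕ) : conj ζ ^ n * ζ ^ n = 1 := by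
  rw [← mul_pow, mul_comm, Complex.mul_conj', hζ]; simp

theorem integral_pow_arcMeasure (n : ℕ) : ∫ ζ, ζ ^ n ∂arcMeasure = if n = 0 then 1 else 0 := by
  have h := integral_cauchyKernel_mul (u := fun z => z ^ n) (w := 0)
    (Differentiable.diffContOnCl (by fun_prop)) (by simp)
  simp only [mul_zero, sub_zero, div_one] at h
  rw [h, zero_pow_eq]

theorem integral_conj_pow_mul_pow (m n : ℕ) :
    ∫ ζ, conj ζ ^ m * ζ ^ n ∂arcMeasure = if m = n then 1 else 0 := by
  have key : ∀ m k : ℕ, ∫ ζ, conj ζ ^ m * ζ ^ (m + k) ∂arcMeasure = if k = 0 then 1 else 0 := by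
    intro m k
    rw [← integral_pow_arcMeasure]
    refine integral_congr_ae ?_
    filter_upwards [ae_norm_eq_one] with ζ hζ
    rw [pow_add, ← mul_assoc, conj_pow_mul_pow hζ, one_mul]
  rcases le_total m n with h | h
  · obtain ⟨k, rfl⟩ := Nat.exists_eq_add_of_le h
    rw [key]
    simp
  · obtain ⟨k, rfl⟩ := Nat.exists_eq_add_of_le h
    have h2 : ∫ ζ, conj ζ ^ (n + k) * ζ ^ n ∂arcMeasure =
        conj (∫ ζ, conj ζ ^ n * ζ ^ (n + k) ∂arcMeasure) := by
      rw [← integral_conj]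
      congr 1 with ζ
      simp [mul_comm]
    rw [h2, key]
    split_ifs <;> simp_all

/-- On the circle conj ζ = ζ⁻¹, which turns the integral into a contour integral of Cauchy type,
with its power series. -/
theorem differentiableOn_cauchyTransform {φ : ℂ → ℂ} (hφ : Integrable φ arcMeasure) :
    DifferentiableOn ℂ (fun z => ∫ ζ, φ ζ / (1 - conj ζ * z) ∂arcMeasure) disc := by
  have h := (hasFPowerSeriesOn_cauchy_integral (R := 1)
    (circleIntegrable_of_integrable hφ) one_pos).differentiableOn
  have hd : Metric.eball (0 : ℂ) ((1 : NNReal) : ℝ≥0∞) = disc := by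
    rw [Metric.eball_coe]; simp [disc]
  rw [hd] at h
  refine h.congr fun z hz => ?_
  rw [mem_disc] at hz
  rw [integral_arcMeasure]
  · have hsq : ∀ ζ ∈ Metric.sphere (0 : ℂ) |1|,
        φ ζ / (1 - conj ζ * z) = ζ * ((ζ - z)⁻¹ * φ ζ) := by
      intro ζ hζ
      have h1 : ‖ζ‖ = 1 := by simpa using hζ
      have h2 := sub_ne_zero_of_norm hz h1
      have h0 : ζ ≠ 0 := by rintro rfl; simp at h1
      have h3 : conj ζ = ζ⁻¹ := by
        rw [Complex.inv_def, Complex.normSq_eq_norm_sq, h1]; simp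
      simp only [h3]
      field_simp
    rw [Real.circleAverage_congr_sphere hsq, Real.circleAverage_eq_circleIntegral one_ne_zero]
    congr 1
    refine circleIntegral.integral_congr zero_le_one fun ζ hζ => ?_
    have h0 : ζ ≠ 0 := by rintro rfl; simp at hζ
    simp only [smul_eq_mul, sub_zero]
    field_simp
  · exact hφ.aestronglyMeasurable.mul
      (aestronglyMeasurable_of_continuousOn (continuousOn_inv_one_sub_conj_mul hz))

/-! ### Fatou's theorem through Lebesgue points. -/

theorem norm_sub_smul_sq {ζ η : ℂ} (hζ : ‖ζ‖ = 1) (hη : ‖η‖ = 1) (r : ℝ) :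
    ‖ζ - r * η‖ ^ 2 = (1 - r) ^ 2 + r * ‖ζ - η‖ ^ 2 := by
  have e1 : ζ.re * ζ.re + ζ.im * ζ.im = 1 := by
    rw [← Complex.normSq_apply, Complex.normSq_eq_norm_sq, hζ]; norm_num
  have e2 : η.re * η.re + η.im * η.im = 1 := by
    rw [← Complex.normSq_apply, Complex.normSq_eq_norm_sq, hη]; norm_num
  rw [← Complex.normSq_eq_norm_sq, ← Complex.normSq_eq_norm_sq, Complex.normSq_apply,
    Complex.normSq_apply]
  simp only [Complex.sub_re, Complex.mul_re, Complex.ofReal_re, Complex.ofReal_im, Complex.sub_im,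
    Complex.mul_im]
  linear_combination (1 - r) * e1 + (r ^ 2 - r) * e2

theorem poissonKernel_smul_le {ζ η : ℂ} (hζ : ‖ζ‖ = 1) (hη : ‖η‖ = 1) {r : ℝ}
    (hr : r ∈ Ioo (1 / 2 : ℝ) 1) :
    poissonKernel 0 (r * η) ζ ≤ 4 * (1 - r) / ((1 - r) ^ 2 + ‖ζ - η‖ ^ 2) := by
  have hr0 : 0 < r := by linarith [hr.1]
  rw [poissonKernel_zero_eq, norm_sub_smul_sq hζ hη, norm_mul, hζ, hη, Complex.norm_real,
    Real.norm_of_nonneg hr0.le]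
  have h1 : 0 < (1 - r) ^ 2 := by have := hr.2; positivity [sub_pos.2 hr.2]
  have h2 := sq_nonneg ‖ζ - η‖
  rw [div_le_div_iff₀ (by positivity) (by positivity)]
  have h3 : 0 < 1 - r := sub_pos.2 hr.2
  have h4 : (1 + r) * ((1 - r) ^ 2 + ‖ζ - η‖ ^ 2) ≤ 4 * ((1 - r) ^ 2 + r * ‖ζ - η‖ ^ 2) := by
    nlinarith [hr.1, hr.2]
  nlinarith [mul_le_mul_of_nonneg_left h4 h3.le]

/-- Only the least j whose ball contains ζ is used. If j = i + 1, then |ζ - η| > 2^i (1 - r), and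
the kernel is at most 4 / (4^i (1 - r)) = 16 · 4^(-j) / (1 - r). -/
theorem ofReal_poissonKernel_le_tsum {ζ η : ℂ} (hζ : ‖ζ‖ = 1) (hη : ‖η‖ = 1) {r : ℝ}
    (hr : r ∈ Ioo (1 / 2 : ℝ) 1) :
    ENNReal.ofReal (poissonKernel 0 (r * η) ζ) ≤
      ∑' j : ℕ, ENNReal.ofReal (16 * (1 / 4) ^ j / (1 - r)) *
        (Metric.closedBall η (2 ^ j * (1 - r))).indicator 1 ζ := by
  have h3 : 0 < 1 - r := sub_pos.2 hr.2
  have hex : ∃ j : ℕ, ‖ζ - η‖ ≤ 2 ^ j * (1 - r) := by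
    obtain ⟨j, hj⟩ := pow_unbounded_of_one_lt (‖ζ - η‖ / (1 - r)) (one_lt_two)
    exact ⟨j, by rw [div_lt_iff₀ h3] at hj; exact hj.le⟩
  classical
  refine le_trans ?_ (ENNReal.le_tsum (Nat.find hex))
  rw [indicator_of_mem (by simpa [dist_eq_norm] using Nat.find_spec hex)]
  simp only [Pi.one_apply, mul_one]
  refine ENNReal.ofReal_le_ofReal ((poissonKernel_smul_le hζ hη hr).trans ?_)
  rcases Nat.eq_zero_or_pos (Nat.find hex) with h0 | h0
  · rw [h0, div_le_div_iff₀ (by positivity) h3]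
    nlinarith [sq_nonneg ‖ζ - η‖, sq_nonneg (1 - r)]
  · obtain ⟨i, hi⟩ := Nat.exists_eq_succ_of_ne_zero h0.ne'
    have hlt : ¬ ‖ζ - η‖ ≤ 2 ^ i * (1 - r) := Nat.find_min hex (by omega)
    push Not at hlt
    rw [hi, div_le_div_iff₀ (by positivity) h3]
    have h5 : (2 ^ i * (1 - r)) ^ 2 ≤ ‖ζ - η‖ ^ 2 := by gcongr
    have h6 : (2 ^ i * (1 - r)) ^ 2 = 4 ^ i * (1 - r) ^ 2 := by
      rw [mul_pow, ← pow_mul, mul_comm i, pow_mul]; norm_num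
    have h7 : (1 / 4 : ℝ) ^ i * 4 ^ i = 1 := by rw [← mul_pow]; norm_num
    have h8 : (1 - r) ^ 2 ≤ (1 / 4) ^ i * ‖ζ - η‖ ^ 2 := by
      calc (1 - r) ^ 2 = (1 / 4) ^ i * (4 ^ i * (1 - r) ^ 2) := by
            rw [← mul_assoc, h7, one_mul]
        _ ≤ _ := by rw [← h6]; gcongr
    have h9 : 0 ≤ (1 / 4 : ℝ) ^ i * (1 - r) ^ 2 := by positivity
    rw [Nat.succ_eq_add_one, pow_succ]
    nlinarith

/-- Half of the decay 4^(-j) is spent on normalizing by the radius; the other half leaves summable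
weights on averages over dyadic balls. -/
theorem lintegral_poissonKernel_mul_le {ψ : ℂ → ℝ≥0∞} (hψ : AEMeasurable ψ arcMeasure) {η : ℂ}
    (hη : ‖η‖ = 1) {r : ℝ} (hr : r ∈ Ioo (1 / 2 : ℝ) 1) :
    ∫⁻ ζ, ENNReal.ofReal (poissonKernel 0 (r * η) ζ) * ψ ζ ∂arcMeasure ≤
      ∑' j : ℕ, ENNReal.ofReal (16 * (1 / 2) ^ j) *
        ((∫⁻ ζ in Metric.closedBall η (2 ^ j * (1 - r)), ψ ζ ∂arcMeasure) /
          ENNReal.ofReal (2 ^ j * (1 - r))) := by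
  have h3 : 0 < 1 - r := sub_pos.2 hr.2
  calc _ ≤ ∫⁻ ζ, ∑' j : ℕ, ENNReal.ofReal (16 * (1 / 4) ^ j / (1 - r)) *
        (Metric.closedBall η (2 ^ j * (1 - r))).indicator ψ ζ ∂arcMeasure := by
        refine lintegral_mono_ae ?_
        filter_upwards [ae_norm_eq_one] with ζ hζ
        refine (mul_le_mul_left (ofReal_poissonKernel_le_tsum hζ hη hr) _).trans_eq ?_
        rw [← ENNReal.tsum_mul_right]
        refine tsum_congr fun j => ?_
        rw [mul_assoc]
        congr 1
        by_cases h : ζ ∈ Metric.closedBall η (2 ^ j * (1 - r)) <;> simp [h]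
    _ = ∑' j : ℕ, ENNReal.ofReal (16 * (1 / 4) ^ j / (1 - r)) *
        ∫⁻ ζ in Metric.closedBall η (2 ^ j * (1 - r)), ψ ζ ∂arcMeasure := by
        rw [lintegral_tsum]
        · refine tsum_congr fun j => ?_
          rw [lintegral_const_mul' _ _ ENNReal.ofReal_ne_top,
            lintegral_indicator Metric.isClosed_closedBall.measurableSet]
        · exact fun j => (hψ.indicator Metric.isClosed_closedBall.measurableSet).const_mul _
    _ = _ := by
        refine tsum_congr fun j => ?_
        rw [ENNReal.div_eq_inv_mul, ← mul_assoc,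
          ← ENNReal.ofReal_inv_of_pos (by positivity), ← ENNReal.ofReal_mul (by positivity)]
        congr 2
        have h2 : (1 / 4 : ℝ) ^ j = (1 / 2) ^ j * (2 ^ j)⁻¹ := by
          rw [← inv_pow, ← mul_pow]; norm_num
        rw [h2]
        field_simp

/-- Almost every point is a Lebesgue point, and the Poisson averages of the oscillation vanish in
the limit at Lebesgue points. -/
theorem ae_tendsto_lintegral_poissonKernel {φ : ℂ → ℂ} (hφ : Integrable φ arcMeasure) :
    ∀ᵐ η ∂arcMeasure, Tendsto (fun r : ℝ => ∫⁻ ζ, ENNReal.ofReal (poissonKernel 0 (r * η) ζ) *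
      ‖φ ζ - φ η‖ₑ ∂arcMeasure) (𝓝[<] 1) (𝓝 0) := by
  filter_upwards [(Besicovitch.vitaliFamily arcMeasure).ae_tendsto_lintegral_enorm_sub_div
    hφ.locallyIntegrable, ae_norm_eq_one] with η hη hη1
  have hF := hη.comp (Besicovitch.tendsto_filterAt arcMeasure η)
  set I : ℝ → ℝ≥0∞ := fun s => ∫⁻ ζ in Metric.closedBall η s, ‖φ ζ - φ η‖ₑ ∂arcMeasure with hI
  have hm : AEMeasurable (fun ζ => ‖φ ζ - φ η‖ₑ) arcMeasure :=
    (hφ.aestronglyMeasurable.sub aestronglyMeasurable_const).enorm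
  -- The ball has measure at most s/2, so dividing by s instead of by the measure only decreases the
  -- quotient.
  have hF0 : Tendsto (fun s => I s / ENNReal.ofReal s) (𝓝[>] 0) (𝓝 0) := by
    refine tendsto_of_tendsto_of_tendsto_of_le_of_le' tendsto_const_nhds hF
      (Eventually.of_forall fun _ => zero_le) ?_
    filter_upwards [self_mem_nhdsWithin] with s hs
    refine ENNReal.div_le_div_left ((arcMeasure_closedBall_le hη1 s).trans ?_) _
    exact ENNReal.ofReal_le_ofReal (by have : 0 < s := hs; linarith)
  have htot : ∫⁻ ζ, ‖φ ζ - φ η‖ₑ ∂arcMeasure < ∞ :=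
    (hφ.sub (integrable_const _)).hasFiniteIntegral
  -- A bound for all radii is needed, because 2^j (1 - r) is not small for large j. It provides the
  -- dominating series.
  obtain ⟨K, hK, hKb⟩ : ∃ K : ℝ≥0∞, K < ∞ ∧ ∀ s > 0, I s / ENNReal.ofReal s ≤ K := by
    have h1 : ∀ᶠ s in 𝓝[>] (0 : ℝ), I s / ENNReal.ofReal s < 1 :=
      hF0.eventually_lt_const one_pos
    obtain ⟨s₀, hs₀, hs₁⟩ := (mem_nhdsGT_iff_exists_Ioo_subset).1 h1
    have hs₀' : (0 : ℝ) < s₀ := hs₀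
    refine ⟨1 + (∫⁻ ζ, ‖φ ζ - φ η‖ₑ ∂arcMeasure) / ENNReal.ofReal s₀, ?_, fun s hs => ?_⟩
    · exact ENNReal.add_lt_top.2 ⟨ENNReal.one_lt_top,
        ENNReal.div_lt_top htot.ne (by simpa using hs₀')⟩
    · rcases lt_or_ge s s₀ with h | h
      · have h2 : I s / ENNReal.ofReal s < 1 := hs₁ ⟨hs, h⟩
        exact h2.le.trans le_self_add
      · refine le_trans ?_ le_add_self
        exact ENNReal.div_le_div (setLIntegral_le_lintegral _ _) (ENNReal.ofReal_le_ofReal h)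
  have hlim : Tendsto (fun r : ℝ => ∑' j : ℕ, ENNReal.ofReal (16 * (1 / 2) ^ j) *
      (I (2 ^ j * (1 - r)) / ENNReal.ofReal (2 ^ j * (1 - r)))) (𝓝[<] 1) (𝓝 0) := by
    -- The series is read as an integral against counting measure, to which dominated convergence
    -- applies.
    simp_rw [← lintegral_count]
    rw [show (0 : ℝ≥0∞) = ∫⁻ _ : ℕ, 0 ∂Measure.count by simp]
    refine tendsto_lintegral_filter_of_dominated_convergence
      (fun j => ENNReal.ofReal (16 * (1 / 2) ^ j) * K) ?_ ?_ ?_ ?_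
    · exact Eventually.of_forall fun _ => measurable_of_countable _
    · filter_upwards [self_mem_nhdsWithin] with r hr
      have h3 : 0 < 1 - r := sub_pos.2 hr
      exact Eventually.of_forall fun j => by
        gcongr
        exact hKb _ (by positivity)
    · rw [lintegral_count, ENNReal.tsum_mul_right]
      refine ENNReal.mul_ne_top ?_ hK.ne
      rw [← ENNReal.ofReal_tsum_of_nonneg (fun j => by positivity)
        ((summable_geometric_of_lt_one (by norm_num) (by norm_num)).mul_left 16)]
      exact ENNReal.ofReal_ne_top
    · refine Eventually.of_forall fun j => ?_
      rw [← mul_zero (ENNReal.ofReal (16 * (1 / 2) ^ j))]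
      refine ENNReal.Tendsto.const_mul ?_ (Or.inr ENNReal.ofReal_ne_top)
      refine hF0.comp (tendsto_nhdsWithin_iff.2 ⟨?_, ?_⟩)
      · have : Tendsto (fun r : ℝ => 2 ^ j * (1 - r)) (𝓝 1) (𝓝 (2 ^ j * (1 - 1))) :=
          (Continuous.tendsto (by fun_prop) 1)
        rw [sub_self, mul_zero] at this
        exact this.mono_left nhdsWithin_le_nhds
      · filter_upwards [self_mem_nhdsWithin] with r hr
        have h3 : 0 < 1 - r := sub_pos.2 hr
        exact mem_Ioi.2 (by positivity)
  refine tendsto_of_tendsto_of_tendsto_of_le_of_le' tendsto_const_nhds hlim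
    (Eventually.of_forall fun _ => zero_le) ?_
  filter_upwards [Ioo_mem_nhdsLT (show (1 / 2 : ℝ) < 1 by norm_num)] with r hr
  exact lintegral_poissonKernel_mul_le hm hη1 hr

theorem integrable_mul_of_continuousOn {φ K : ℂ → ℂ} (hφ : Integrable φ arcMeasure)
    (hK : ContinuousOn K (Metric.sphere (0 : ℂ) 1)) :
    Integrable (fun ζ => K ζ * φ ζ) arcMeasure := by
  obtain ⟨C, hC⟩ := (isCompact_sphere (0 : ℂ) 1).exists_bound_of_continuousOn hK
  exact hφ.bdd_mul (aestronglyMeasurable_of_continuousOn hK)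
    (by filter_upwards [ae_mem_sphere] with ζ h using hC ζ h)

theorem norm_smul_lt_one {η : ℂ} (hη : ‖η‖ = 1) {r : ℝ} (hr : r ∈ Ioo (0 : ℝ) 1) :
    ‖(r : ℂ) * η‖ < 1 := by
  rw [norm_mul, hη, Complex.norm_real, Real.norm_of_nonneg hr.1.le, mul_one]
  exact hr.2

theorem continuousOn_ofReal_poissonKernel {w : ℂ} (hw : ‖w‖ < 1) :
    ContinuousOn (fun ζ => (poissonKernel 0 w ζ : ℂ)) (Metric.sphere (0 : ℂ) 1) :=
  Complex.continuous_ofReal.comp_continuousOn (continuousOn_poissonKernel hw)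

/-- **Fatou's theorem** for Poisson integrals of integrable functions. -/
theorem ae_tendsto_integral_poissonKernel {φ : ℂ → ℂ} (hφ : Integrable φ arcMeasure) :
    ∀ᵐ η ∂arcMeasure, Tendsto (fun r : ℝ => ∫ ζ, (poissonKernel 0 (r * η) ζ : ℂ) *
      φ ζ ∂arcMeasure) (𝓝[<] 1) (𝓝 (φ η)) := by
  filter_upwards [ae_tendsto_lintegral_poissonKernel hφ, ae_norm_eq_one] with η hη hη1
  rw [tendsto_iff_edist_tendsto_0]
  refine tendsto_of_tendsto_of_tendsto_of_le_of_le' tendsto_const_nhds hη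
    (Eventually.of_forall fun _ => zero_le) ?_
  filter_upwards [Ioo_mem_nhdsLT (show (0 : ℝ) < 1 by norm_num)] with r hr
  have hw := norm_smul_lt_one hη1 hr
  have hK := continuousOn_ofReal_poissonKernel hw
  -- The Poisson kernel has total mass one.
  have h1 : φ η = ∫ ζ, (poissonKernel 0 (r * η) ζ : ℂ) * φ η ∂arcMeasure :=
    (integral_poissonKernel_mul (u := fun _ => φ η) diffContOnCl_const hw).symm
  rw [edist_eq_enorm_sub]
  conv_lhs => rw [h1]
  rw [← integral_sub (integrable_mul_of_continuousOn hφ hK)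
    (integrable_mul_of_continuousOn (integrable_const _) hK)]
  refine (enorm_integral_le_lintegral_enorm _).trans (lintegral_mono_ae ?_)
  filter_upwards [ae_norm_eq_one] with ζ hζ
  rw [← mul_sub, enorm_mul]
  refine mul_le_mul' (le_of_eq ?_) le_rfl
  rw [← ofReal_norm, Complex.norm_real, Real.norm_of_nonneg (poissonKernel_nonneg hw hζ)]

/-! ### Power series with square summable coefficients and their products. -/

/-- The function `ζ ↦ ζ ^ n` as an element of `L²` of the circle. -/
def circleMonomial (n : ℕ) : Lp ℂ 2 arcMeasure :=
  (memLp_of_continuousOn (F := fun ζ : ℂ => ζ ^ n) (by fun_prop) 2).toLp _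

theorem inner_toLp {F G : ℂ → ℂ} (hF : MemLp F 2 arcMeasure) (hG : MemLp G 2 arcMeasure) :
    inner ℂ (hF.toLp F) (hG.toLp G) = ∫ ζ, conj (F ζ) * G ζ ∂arcMeasure := by
  rw [L2.inner_def]
  refine integral_congr_ae ?_
  filter_upwards [hF.coeFn_toLp, hG.coeFn_toLp] with ζ h1 h2
  rw [h1, h2, RCLike.inner_apply, mul_comm]

theorem orthonormal_circleMonomial : Orthonormal ℂ circleMonomial := by
  rw [orthonormal_iff_ite]
  intro i j
  rw [circleMonomial, circleMonomial, inner_toLp]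
  simp only [map_pow]
  exact integral_conj_pow_mul_pow i j

/-- Riesz–Fischer for the orthonormal monomials. -/
theorem exists_tendsto_eLpNorm_of_summable_sq {a : ℕ → ℂ} (ha : Summable fun n => ‖a n‖ ^ 2) :
    ∃ A : ℂ → ℂ, MemLp A 2 arcMeasure ∧ Tendsto (fun N => eLpNorm
      ((fun ζ => ∑ n ∈ Finset.range N, a n * ζ ^ n) - A) 2 arcMeasure) atTop (𝓝 0) := by
  have hs : Summable fun n => a n • circleMonomial n := by
    have h := (orthonormal_circleMonomial.orthogonalFamily.summable_iff_norm_sq_summable a).2 ha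
    simpa using h
  obtain ⟨A, hA⟩ := hs
  refine ⟨A, Lp.memLp A, ?_⟩
  have h := (Lp.tendsto_Lp_iff_tendsto_eLpNorm' _ _).1 hA.tendsto_sum_nat
  refine h.congr fun N => eLpNorm_congr_ae ?_
  refine EventuallyEq.sub ?_ EventuallyEq.rfl
  induction N with
  | zero =>
    simp only [Finset.range_zero, Finset.sum_empty]
    exact Lp.coeFn_zero ℂ 2 arcMeasure
  | succ N ih =>
    rw [Finset.sum_range_succ]
    filter_upwards [ih, Lp.coeFn_add (∑ i ∈ Finset.range N, a i • circleMonomial i)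
      (a N • circleMonomial N), Lp.coeFn_smul (a N) (circleMonomial N),
      (memLp_of_continuousOn (F := fun ζ : ℂ => ζ ^ N) (by fun_prop) 2).coeFn_toLp]
      with ζ h1 h2 h3 h4
    rw [h2, Pi.add_apply, h1, h3, Pi.smul_apply, Finset.sum_range_succ, circleMonomial, h4,
      smul_eq_mul]

/-- Cauchy–Schwarz applied to F G - A B = F (G - B) + (F - A) B. This is what makes H² factors
useful for H¹. -/
theorem tendsto_eLpNorm_mul {F G : ℕ → ℂ → ℂ} {A B : ℂ → ℂ}
    (hFm : ∀ N, MemLp (F N) 2 arcMeasure) (hGm : ∀ N, MemLp (G N) 2 arcMeasure)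
    (hA : MemLp A 2 arcMeasure) (hB : MemLp B 2 arcMeasure)
    (hF : Tendsto (fun N => eLpNorm (F N - A) 2 arcMeasure) atTop (𝓝 0))
    (hG : Tendsto (fun N => eLpNorm (G N - B) 2 arcMeasure) atTop (𝓝 0)) :
    Tendsto (fun N => eLpNorm (F N * G N - A * B) 1 arcMeasure) atTop (𝓝 0) := by
  have hle : ∀ N, eLpNorm (F N * G N - A * B) 1 arcMeasure ≤
      (eLpNorm (F N - A) 2 arcMeasure + eLpNorm A 2 arcMeasure) *
        eLpNorm (G N - B) 2 arcMeasure +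
      eLpNorm (F N - A) 2 arcMeasure * eLpNorm B 2 arcMeasure := by
    intro N
    have h1 : F N * G N - A * B = F N • (G N - B) + (F N - A) • B := by
      simp only [smul_eq_mul]; ring
    have m1 := ((hGm N).sub hB).1
    have m2 := ((hFm N).sub hA).1
    rw [h1]
    refine (eLpNorm_add_le ((hFm N).1.smul m1) (m2.smul hB.1) le_rfl).trans ?_
    refine add_le_add ((eLpNorm_smul_le_mul_eLpNorm (p := 2) (q := 2) m1 (hFm N).1).trans ?_)
      (eLpNorm_smul_le_mul_eLpNorm (p := 2) (q := 2) hB.1 m2)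
    gcongr
    have h2 : F N = (F N - A) + A := by ring
    conv_lhs => rw [h2]
    exact eLpNorm_add_le m2 hA.1 (by norm_num)
  have hlim : Tendsto (fun N => (eLpNorm (F N - A) 2 arcMeasure + eLpNorm A 2 arcMeasure) *
        eLpNorm (G N - B) 2 arcMeasure +
      eLpNorm (F N - A) 2 arcMeasure * eLpNorm B 2 arcMeasure) atTop (𝓝 0) := by
    have h3 := (ENNReal.Tendsto.mul (hF.add_const (eLpNorm A 2 arcMeasure))
      (Or.inr ENNReal.zero_ne_top) hG (Or.inr (by simpa using hA.2.ne))).add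
      (ENNReal.Tendsto.mul_const (b := eLpNorm B 2 arcMeasure) hF (Or.inr hB.2.ne))
    simpa using h3
  exact tendsto_of_tendsto_of_tendsto_of_le_of_le tendsto_const_nhds hlim (fun _ => zero_le) hle

theorem tendsto_integral_mul_of_eLpNorm {F : ℕ → ℂ → ℂ} {A K : ℂ → ℂ}
    (hFm : ∀ N, Integrable (F N) arcMeasure) (hA : Integrable A arcMeasure)
    (hF : Tendsto (fun N => eLpNorm (F N - A) 1 arcMeasure) atTop (𝓝 0))
    (hK : ContinuousOn K (Metric.sphere (0 : ℂ) 1)) :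
    Tendsto (fun N => ∫ ζ, K ζ * F N ζ ∂arcMeasure) atTop (𝓝 (∫ ζ, K ζ * A ζ ∂arcMeasure)) := by
  refine tendsto_integral_of_L1' _ (integrable_mul_of_continuousOn hA hK).1
    (Eventually.of_forall fun N => integrable_mul_of_continuousOn (hFm N) hK) ?_
  have hle : ∀ N, eLpNorm ((fun ζ => K ζ * F N ζ) - fun ζ => K ζ * A ζ) 1 arcMeasure ≤
      eLpNorm K ∞ arcMeasure * eLpNorm (F N - A) 1 arcMeasure := by
    intro N
    have h1 : ((fun ζ => K ζ * F N ζ) - fun ζ => K ζ * A ζ) = K • (F N - A) := by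
      ext ζ; simp [mul_sub]
    rw [h1]
    exact eLpNorm_smul_le_eLpNorm_top_mul_eLpNorm 1 ((hFm N).sub hA).1 K
  have hlim := ENNReal.Tendsto.const_mul (a := eLpNorm K ∞ arcMeasure) hF
    (Or.inr (memLp_of_continuousOn hK ∞).2.ne)
  rw [mul_zero] at hlim
  exact tendsto_of_tendsto_of_tendsto_of_le_of_le tendsto_const_nhds hlim (fun _ => zero_le) hle

theorem summable_norm_mul_pow {a : ℕ → ℂ} {C : ℝ} (ha : ∀ n, ‖a n‖ ≤ C) {z : ℂ} (hz : ‖z‖ < 1) :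
    Summable fun n => ‖a n * z ^ n‖ := by
  refine Summable.of_nonneg_of_le (fun _ => norm_nonneg _) (fun n => ?_)
    ((summable_geometric_of_lt_one (norm_nonneg z) hz).mul_left C)
  rw [norm_mul, norm_pow]
  gcongr
  exact ha n

theorem exists_norm_le_of_summable_sq {a : ℕ → ℂ} (ha : Summable fun n => ‖a n‖ ^ 2) :
    ∃ C, ∀ n, ‖a n‖ ≤ C :=
  ⟨Real.sqrt (∑' n, ‖a n‖ ^ 2), fun n => Real.le_sqrt_of_sq_le
    (ha.le_tsum n fun _ _ => sq_nonneg _)⟩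

theorem tendsto_sum_range_mul_pow {a : ℕ → ℂ} (ha : Summable fun n => ‖a n‖ ^ 2) {z : ℂ}
    (hz : ‖z‖ < 1) : Tendsto (fun N => ∑ n ∈ Finset.range N, a n * z ^ n) atTop
      (𝓝 (∑' n, a n * z ^ n)) := by
  obtain ⟨C, hC⟩ := exists_norm_le_of_summable_sq ha
  exact (summable_norm_mul_pow hC hz).of_norm.hasSum.tendsto_sum_nat

/-- Radial boundary values of power series with square summable coefficients. -/
theorem ae_tendsto_tsum_of_tendsto_eLpNorm {a : ℕ → ℂ} (ha : Summable fun n => ‖a n‖ ^ 2)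
    {A : ℂ → ℂ} (hA : MemLp A 2 arcMeasure) (hlim : Tendsto (fun N => eLpNorm
      ((fun ζ => ∑ n ∈ Finset.range N, a n * ζ ^ n) - A) 2 arcMeasure) atTop (𝓝 0)) :
    ∀ᵐ η ∂arcMeasure, Tendsto (fun r : ℝ => ∑' n, a n * (r * η) ^ n) (𝓝[<] 1) (𝓝 (A η)) := by
  have hA1 : Integrable A arcMeasure := hA.integrable (by norm_num)
  have hS : ∀ N, Continuous fun ζ : ℂ => ∑ n ∈ Finset.range N, a n * ζ ^ n := fun N => by
    fun_prop
  have hlim1 : Tendsto (fun N => eLpNorm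
      ((fun ζ => ∑ n ∈ Finset.range N, a n * ζ ^ n) - A) 1 arcMeasure) atTop (𝓝 0) := by
    refine tendsto_of_tendsto_of_tendsto_of_le_of_le tendsto_const_nhds hlim
      (fun _ => zero_le) fun N => ?_
    exact eLpNorm_le_eLpNorm_of_exponent_le (by norm_num)
      ((aestronglyMeasurable_of_continuousOn (hS N).continuousOn).sub hA.1)
  -- The power series is the Poisson integral of its L² boundary function, since this holds for the
  -- partial sums; then Fatou's theorem applies.
  have hrep : ∀ z : ℂ, ‖z‖ < 1 →
      ∑' n, a n * z ^ n = ∫ ζ, (poissonKernel 0 z ζ : ℂ) * A ζ ∂arcMeasure := by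
    intro z hz
    refine tendsto_nhds_unique (tendsto_sum_range_mul_pow ha hz) ?_
    refine (tendsto_integral_mul_of_eLpNorm
      (fun N => integrable_of_continuousOn (hS N).continuousOn) hA1 hlim1
      (continuousOn_ofReal_poissonKernel hz)).congr fun N => ?_
    exact integral_poissonKernel_mul (Differentiable.diffContOnCl (by fun_prop)) hz
  filter_upwards [ae_tendsto_integral_poissonKernel hA1, ae_norm_eq_one] with η hη hη1
  refine hη.congr' ?_
  filter_upwards [Ioo_mem_nhdsLT (show (0 : ℝ) < 1 by norm_num)] with r hr
  exact (hrep _ (norm_smul_lt_one hη1 hr)).symm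

/-- Cauchy's formula holds for the products of partial sums, which are polynomials, and survives
their L¹ limit. -/
theorem exists_boundary_of_summable_sq_mul {a b : ℕ → ℂ} (ha : Summable fun n => ‖a n‖ ^ 2)
    (hb : Summable fun n => ‖b n‖ ^ 2) :
    ∃ Φ : ℂ → ℂ, Integrable Φ arcMeasure ∧
      (∀ᵐ η ∂arcMeasure, Tendsto (fun r : ℝ => (∑' n, a n * (r * η) ^ n) * ∑' n, b n * (r * η) ^ n)
        (𝓝[<] 1) (𝓝 (Φ η))) ∧
      ∀ z, ‖z‖ < 1 → ∫ ζ, Φ ζ / (1 - conj ζ * z) ∂arcMeasure =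
        (∑' n, a n * z ^ n) * ∑' n, b n * z ^ n := by
  obtain ⟨A, hA, hAl⟩ := exists_tendsto_eLpNorm_of_summable_sq ha
  obtain ⟨B, hB, hBl⟩ := exists_tendsto_eLpNorm_of_summable_sq hb
  have hAB : Integrable (A * B) arcMeasure := hA.integrable_mul hB
  have hS : ∀ (a : ℕ → ℂ) (N : ℕ), Continuous fun ζ : ℂ => ∑ n ∈ Finset.range N, a n * ζ ^ n :=
    fun a N => by fun_prop
  refine ⟨A * B, hAB, ?_, fun z hz => ?_⟩
  · filter_upwards [ae_tendsto_tsum_of_tendsto_eLpNorm ha hA hAl,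
      ae_tendsto_tsum_of_tendsto_eLpNorm hb hB hBl] with η h1 h2 using h1.mul h2
  · have h1 := tendsto_eLpNorm_mul
      (fun N => memLp_of_continuousOn (hS a N).continuousOn 2)
      (fun N => memLp_of_continuousOn (hS b N).continuousOn 2) hA hB hAl hBl
    have h2 := tendsto_integral_mul_of_eLpNorm
      (fun N => integrable_of_continuousOn ((hS a N).mul (hS b N)).continuousOn) hAB h1
      (continuousOn_inv_one_sub_conj_mul hz)
    simp_rw [div_eq_inv_mul]
    refine tendsto_nhds_unique h2 (((tendsto_sum_range_mul_pow ha hz).mul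
      (tendsto_sum_range_mul_pow hb hz)).congr fun N => ?_)
    have h3 := integral_cauchyKernel_mul (u := fun z =>
      (∑ n ∈ Finset.range N, a n * z ^ n) * ∑ n ∈ Finset.range N, b n * z ^ n)
      (Differentiable.diffContOnCl (by fun_prop)) hz
    rw [← h3]
    simp_rw [div_eq_inv_mul]
    rfl

/-! ### Taylor coefficients as Fourier coefficients on circles. -/

theorem hasSum_of_eq_of_hasSum {f g : ℕ → ℂ} {x : ℂ} (hg : HasSum g x) (h : ∀ n, f n = g n) :
    HasSum f x := by
  rwa [funext h]

theorem hasSum_taylorCoeff {u : ℂ → ℂ} (hu : DifferentiableOn ℂ u disc) {z : ℂ} (hz : ‖z‖ < 1) :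
    HasSum (fun n => taylorCoeff u n * z ^ n) (u z) := by
  have h := Complex.hasSum_taylorSeries_on_ball (c := 0) (r := 1) (f := u) hu
    (z := z) (by simpa using hz)
  refine hasSum_of_eq_of_hasSum h fun n => ?_
  rw [taylorCoeff, smul_eq_mul, smul_eq_mul, sub_zero]
  ring

theorem contDiffAt_zero {u : ℂ → ℂ} (hu : DifferentiableOn ℂ u disc) (n : ℕ) :
    ContDiffAt ℂ n u 0 :=
  (hu.analyticAt (isOpen_disc.mem_nhds (by simp [mem_disc]))).contDiffAt

theorem taylorCoeff_congr {u v : ℂ → ℂ} (h : EqOn u v disc) : taylorCoeff u = taylorCoeff v := by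
  ext n
  have h' : u =ᶠ[𝓝 0] v := h.eventuallyEq_of_mem (isOpen_disc.mem_nhds (by simp [mem_disc]))
  rw [taylorCoeff, taylorCoeff, h'.iteratedDeriv_eq]

theorem taylorCoeff_mul {u v : ℂ → ℂ} (hu : DifferentiableOn ℂ u disc)
    (hv : DifferentiableOn ℂ v disc) (n : ℕ) :
    taylorCoeff (u * v) n =
      ∑ k ∈ Finset.range (n + 1), taylorCoeff u k * taylorCoeff v (n - k) := by
  rw [taylorCoeff, iteratedDeriv_mul (contDiffAt_zero hu n) (contDiffAt_zero hv n),
    Finset.sum_div]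
  refine Finset.sum_congr rfl fun k hk => ?_
  have hkn : k ≤ n := Nat.lt_succ_iff.1 (Finset.mem_range.1 hk)
  rw [taylorCoeff, taylorCoeff, Nat.cast_choose ℂ hkn]
  have h1 : (n.factorial : ℂ) ≠ 0 := by exact_mod_cast n.factorial_ne_zero
  field_simp

theorem norm_ofReal_mul_lt_one {ρ : ℝ} (hρ : ρ ∈ Ioo (0 : ℝ) 1) {z : ℂ} (hz : ‖z‖ ≤ 1) :
    ‖(ρ : ℂ) * z‖ < 1 := by
  rw [norm_mul, Complex.norm_real, Real.norm_of_nonneg hρ.1.le]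
  nlinarith [hρ.1, hρ.2]

/-- Convergence at a radius s between ρ and 1 bounds the terms there; comparison with the geometric
series of ratio ρ/s follows. -/
theorem summable_norm_taylorCoeff {u : ℂ → ℂ} (hu : DifferentiableOn ℂ u disc) {ρ : ℝ}
    (hρ : ρ ∈ Ioo (0 : ℝ) 1) : Summable fun n => ‖taylorCoeff u n‖ * ρ ^ n := by
  obtain ⟨s, hs⟩ := exists_between hρ.2
  have hs0 : 0 < s := hρ.1.trans hs.1
  have h1 := (hasSum_taylorCoeff hu (z := (s : ℂ))
    (by rw [Complex.norm_real, Real.norm_of_nonneg hs0.le]; exact hs.2)).summable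
  obtain ⟨C, hC⟩ := h1.tendsto_atTop_zero.norm.bddAbove_range
  refine Summable.of_nonneg_of_le (fun n => by have := hρ.1; positivity) (fun n => ?_)
    ((summable_geometric_of_lt_one (by have := hρ.1; positivity : 0 ≤ ρ / s)
      ((div_lt_one hs0).2 hs.1)).mul_left C)
  have h2 : ‖taylorCoeff u n * (s : ℂ) ^ n‖ ≤ C := hC ⟨n, rfl⟩
  rw [norm_mul, norm_pow, Complex.norm_real, Real.norm_of_nonneg hs0.le] at h2
  calc ‖taylorCoeff u n‖ * ρ ^ n = (‖taylorCoeff u n‖ * s ^ n) * (ρ / s) ^ n := by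
        rw [div_pow]; field_simp
    _ ≤ _ := by have := hρ.1; gcongr

theorem continuousOn_dilation {u : ℂ → ℂ} (hu : DifferentiableOn ℂ u disc) {ρ : ℝ}
    (hρ : ρ ∈ Ioo (0 : ℝ) 1) :
    ContinuousOn (fun z => u (ρ * z)) (Metric.sphere (0 : ℂ) 1) :=
  continuousOn_sphere_of_diffContOnCl (diffContOnCl_dilation hu hρ)

/-- Termwise integration of the Taylor series of a dilation against a continuous function. -/
theorem hasSum_integral_mul_dilation {u : ℂ → ℂ} (hu : DifferentiableOn ℂ u disc) {z : ℂ}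
    (hz : ‖z‖ < 1) {K : ℂ → ℂ} (hK : ContinuousOn K (Metric.sphere (0 : ℂ) 1)) :
    HasSum (fun n => taylorCoeff u n * z ^ n * ∫ ζ, K ζ * ζ ^ n ∂arcMeasure)
      (∫ ζ, K ζ * u (z * ζ) ∂arcMeasure) := by
  obtain ⟨C, hC⟩ := (isCompact_sphere (0 : ℂ) 1).exists_bound_of_continuousOn hK
  have hsum : Summable fun n => ‖taylorCoeff u n * z ^ n‖ := by
    -- The point 0 is separate because `summable_norm_taylorCoeff` asks for a positive radius.
    rcases eq_or_ne z 0 with rfl | h0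
    · refine summable_of_ne_finset_zero (s := {0}) fun n hn => ?_
      simp [zero_pow (by simpa using hn : n ≠ 0)]
    · simpa using summable_norm_taylorCoeff hu (ρ := ‖z‖) ⟨norm_pos_iff.2 h0, hz⟩
  have h := hasSum_integral_of_dominated_convergence (μ := arcMeasure)
    (F := fun n ζ => taylorCoeff u n * z ^ n * (K ζ * ζ ^ n)) (f := fun ζ => K ζ * u (z * ζ))
    (fun n _ => ‖taylorCoeff u n * z ^ n‖ * C)
    (fun n => aestronglyMeasurable_of_continuousOn (by fun_prop)) (fun n => ?_)
    (Eventually.of_forall fun _ => hsum.mul_right C) (integrable_const _) ?_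
  · simpa only [integral_const_mul] using h
  · filter_upwards [ae_mem_sphere] with ζ hζ
    rw [norm_mul, norm_mul (K ζ), norm_pow, show ‖ζ‖ = 1 by simpa using hζ, one_pow, mul_one]
    gcongr
    exact hC ζ hζ
  · filter_upwards [ae_norm_eq_one] with ζ hζ
    have h1 := (hasSum_taylorCoeff hu (z := z * ζ) (by rwa [norm_mul, hζ, mul_one])).mul_left (K ζ)
    refine hasSum_of_eq_of_hasSum h1 fun n => ?_
    rw [mul_pow]
    ring

theorem integral_conj_pow_mul_dilation {u : ℂ → ℂ} (hu : DifferentiableOn ℂ u disc) {z : ℂ}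
    (hz : ‖z‖ < 1) (n : ℕ) :
    ∫ ζ, conj ζ ^ n * u (z * ζ) ∂arcMeasure = taylorCoeff u n * z ^ n := by
  have h := hasSum_integral_mul_dilation hu hz (K := fun ζ => conj ζ ^ n) (by fun_prop)
  simp only [integral_conj_pow_mul_pow] at h
  refine h.unique ?_
  have h2 := hasSum_ite_eq n (taylorCoeff u n * z ^ n)
  refine hasSum_of_eq_of_hasSum h2 fun k => ?_
  by_cases hk : k = n
  · simp [hk]
  · simp [hk, Ne.symm hk]

/-- **Bessel's inequality** on circles. -/
theorem sum_sq_taylorCoeff_le {u : ℂ → ℂ} (hu : DifferentiableOn ℂ u disc) {ρ : ℝ}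
    (hρ : ρ ∈ Ioo (0 : ℝ) 1) (N : ℕ) :
    ∑ n ∈ Finset.range N, ‖taylorCoeff u n * (ρ : ℂ) ^ n‖ ^ 2 ≤
      ∫ ζ, ‖u (ρ * ζ)‖ ^ 2 ∂arcMeasure := by
  have hm := memLp_of_continuousOn (continuousOn_dilation hu hρ) 2
  have hρ1 : ‖(ρ : ℂ)‖ < 1 := by simpa using norm_ofReal_mul_lt_one hρ (z := 1) (by simp)
  have h := orthonormal_circleMonomial.sum_inner_products_le (hm.toLp _) (s := Finset.range N)
  have h1 : ‖hm.toLp _‖ ^ 2 = ∫ ζ, ‖u (ρ * ζ)‖ ^ 2 ∂arcMeasure := by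
    have h2 : ((‖hm.toLp _‖ ^ 2 : ℝ) : ℂ) = ((∫ ζ, ‖u (ρ * ζ)‖ ^ 2 ∂arcMeasure : ℝ) : ℂ) := by
      push_cast
      rw [← integral_complex_ofReal]
      refine (inner_self_eq_norm_sq_to_K (𝕜 := ℂ) (hm.toLp _)).symm.trans ?_
      rw [inner_toLp]
      refine integral_congr_ae (Eventually.of_forall fun ζ => ?_)
      simp [Complex.conj_mul']
    exact_mod_cast h2
  rw [h1] at h
  refine le_trans (le_of_eq (Finset.sum_congr rfl fun n _ => ?_)) h
  rw [circleMonomial, inner_toLp]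
  simp only [map_pow]
  rw [integral_conj_pow_mul_dilation hu hρ1]

theorem taylorCoeff_polynomial (P : Polynomial ℂ) (n : ℕ) :
    taylorCoeff (fun z => P.eval z) n = P.coeff n := by
  have hd : DifferentiableOn ℂ (fun z => P.eval z) disc := P.differentiable.differentiableOn
  have hz : ‖(1 / 2 : ℂ)‖ < 1 := by norm_num
  have h := integral_conj_pow_mul_dilation hd hz n
  have h2 : ∀ ζ : ℂ, conj ζ ^ n * P.eval (1 / 2 * ζ) = ∑ k ∈ Finset.range (P.natDegree + 1),
      P.coeff k * (1 / 2) ^ k * (conj ζ ^ n * ζ ^ k) := by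
    intro ζ
    rw [Polynomial.eval_eq_sum_range, Finset.mul_sum]
    refine Finset.sum_congr rfl fun k _ => ?_
    rw [mul_pow]
    ring
  simp_rw [h2] at h
  rw [integral_finsetSum _ fun k _ => (integrable_of_continuousOn (by fun_prop))] at h
  simp_rw [integral_const_mul, integral_conj_pow_mul_pow] at h
  simp only [mul_ite, mul_one, mul_zero, Finset.sum_ite_eq, Finset.mem_range] at h
  have h3 : (1 / 2 : ℂ) ^ n ≠ 0 := pow_ne_zero _ (by norm_num)
  refine mul_right_cancel₀ h3 (h.symm.trans ?_)
  split_ifs with h4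
  · rfl
  · rw [P.coeff_eq_zero_of_natDegree_lt (by omega), zero_mul]

/-! ### Factorization of H¹ functions into H² functions. -/

/-- A polynomial `P` is a product `a * b` in the disc of two analytic functions, the squares of
which are dominated by a polynomial that has the modulus of `P` on the circle. -/
def IsSquareDominated (P : Polynomial ℂ) : Prop :=
  ∃ (Q : Polynomial ℂ) (a b : ℂ → ℂ), DifferentiableOn ℂ a disc ∧ DifferentiableOn ℂ b disc ∧
    (∀ z ∈ disc, P.eval z = a z * b z ∧ ‖a z‖ ^ 2 ≤ ‖Q.eval z‖ ∧ ‖b z‖ ^ 2 ≤ ‖Q.eval z‖) ∧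
    ∀ z : ℂ, ‖z‖ = 1 → ‖Q.eval z‖ = ‖P.eval z‖

theorem IsSquareDominated.mul {P₁ P₂ : Polynomial ℂ} (h₁ : IsSquareDominated P₁)
    (h₂ : IsSquareDominated P₂) : IsSquareDominated (P₁ * P₂) := by
  obtain ⟨Q₁, a₁, b₁, ha₁, hb₁, hd₁, hc₁⟩ := h₁
  obtain ⟨Q₂, a₂, b₂, ha₂, hb₂, hd₂, hc₂⟩ := h₂
  refine ⟨Q₁ * Q₂, a₁ * a₂, b₁ * b₂, ha₁.mul ha₂, hb₁.mul hb₂, fun z hz => ?_, fun z hz => ?_⟩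
  · obtain ⟨e₁, f₁, g₁⟩ := hd₁ z hz
    obtain ⟨e₂, f₂, g₂⟩ := hd₂ z hz
    simp only [Polynomial.eval_mul, Pi.mul_apply, norm_mul, mul_pow]
    refine ⟨by rw [e₁, e₂]; ring, ?_, ?_⟩ <;> gcongr
  · simp [hc₁ z hz, hc₂ z hz]

theorem isSquareDominated_C (c : ℂ) : IsSquareDominated (Polynomial.C c) := by
  obtain ⟨s, hs⟩ := IsAlgClosed.exists_pow_nat_eq c two_pos
  have h : ‖s‖ ^ 2 ≤ ‖c‖ := by rw [← norm_pow, hs]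
  exact ⟨Polynomial.C c, fun _ => s, fun _ => s, differentiableOn_const _, differentiableOn_const _,
    fun z _ => ⟨by rw [Polynomial.eval_C, ← hs, sq], by simpa using h, by simpa using h⟩,
    fun _ _ => rfl⟩

/-- The values 1 - uz have positive real part in the disc, so the principal logarithm gives an
analytic square root without zeros. -/
theorem exists_sqrt_one_sub_mul {u : ℂ} (hu : ‖u‖ ≤ 1) :
    ∃ b : ℂ → ℂ, DifferentiableOn ℂ b disc ∧ ∀ z ∈ disc, b z ^ 2 = 1 - u * z ∧ b z ≠ 0 := by
  have hre : ∀ z ∈ disc, 1 - u * z ∈ Complex.slitPlane := by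
    intro z hz
    left
    have h1 : (u * z).re ≤ ‖u * z‖ := Complex.re_le_norm _
    have h2 : ‖u * z‖ < 1 := by
      rw [norm_mul]
      have := mem_disc.1 hz
      nlinarith [norm_nonneg z]
    simp only [Complex.sub_re, Complex.one_re]
    linarith
  refine ⟨fun z => Complex.exp (Complex.log (1 - u * z) / 2), fun z hz => ?_, fun z hz => ⟨?_, ?_⟩⟩
  · have := hre z hz
    have h1 : DifferentiableAt ℂ (fun z => 1 - u * z) z := by fun_prop
    exact ((h1.clog this).div_const 2).cexp.differentiableWithinAt
  · rw [← Complex.exp_nat_mul]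
    push_cast
    rw [mul_div_cancel₀ _ (by norm_num), Complex.exp_log (Complex.slitPlane_ne_zero (hre z hz))]
  · exact Complex.exp_ne_zero _

/-- The difference of the squares is (1 - |z|²)(1 - |w|²). -/
theorem norm_sub_le_norm_one_sub {w z : ℂ} (hw : ‖w‖ ≤ 1) (hz : ‖z‖ ≤ 1) :
    ‖z - w‖ ≤ ‖1 - conj w * z‖ := by
  rw [← sq_le_sq₀ (norm_nonneg _) (norm_nonneg _), ← Complex.normSq_eq_norm_sq,
    ← Complex.normSq_eq_norm_sq, Complex.normSq_sub, Complex.normSq_sub]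
  have h1 : (1 * conj (conj w * z)).re = (z * conj w).re := by
    simp [mul_comm]
  have h2 : Complex.normSq w ≤ 1 := by rw [Complex.normSq_eq_norm_sq]; nlinarith [norm_nonneg w]
  have h3 : Complex.normSq z ≤ 1 := by rw [Complex.normSq_eq_norm_sq]; nlinarith [norm_nonneg z]
  rw [h1, Complex.normSq_mul, Complex.normSq_conj, Complex.normSq_one]
  nlinarith

/-- For |w| < 1 the root is reflected: Q = 1 - conj w z has no zero in the disc, b is its square
root and a = (z - w)/b, a Blaschke factor times b. For |w| ≥ 1 the factor z - w is itself a square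
in the disc, with Q = z - w. -/
theorem isSquareDominated_X_sub_C (w : ℂ) :
    IsSquareDominated (Polynomial.X - Polynomial.C w) := by
  rcases lt_or_ge ‖w‖ 1 with hw | hw
  · obtain ⟨b, hb, hb2⟩ := exists_sqrt_one_sub_mul (u := conj w) (by simpa using hw.le)
    have hbn : ∀ z ∈ disc, ‖b z‖ ^ 2 = ‖1 - conj w * z‖ := fun z hz => by
      rw [← norm_pow, (hb2 z hz).1]
    refine ⟨1 - Polynomial.C (conj w) * Polynomial.X, fun z => (z - w) / b z, b,
      DifferentiableOn.div (by fun_prop) hb fun z hz => (hb2 z hz).2, hb, fun z hz => ⟨?_, ?_, ?_⟩,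
      fun z hz => ?_⟩
    · simp [div_mul_cancel₀ _ (hb2 z hz).2]
    · have h1 := norm_sub_le_norm_one_sub hw.le (mem_disc.1 hz).le
      have h2 : 0 < ‖b z‖ ^ 2 := by have := (hb2 z hz).2; positivity
      rw [norm_div, div_pow, div_le_iff₀ h2, hbn z hz]
      simp only [Polynomial.eval_sub, Polynomial.eval_one, Polynomial.eval_mul, Polynomial.eval_C,
        Polynomial.eval_X]
      nlinarith [norm_nonneg (z - w), norm_nonneg (1 - conj w * z)]
    · simp [hbn z hz]
    · simp only [Polynomial.eval_sub, Polynomial.eval_one, Polynomial.eval_mul, Polynomial.eval_C,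
        Polynomial.eval_X]
      rw [← norm_one_sub_conj_mul hz, ← RCLike.norm_conj]
      simp [mul_comm]
  · have hw0 : w ≠ 0 := by rintro rfl; simp at hw; linarith
    obtain ⟨b, hb, hb2⟩ := exists_sqrt_one_sub_mul (u := w⁻¹)
      (by rw [norm_inv]; exact inv_le_one_of_one_le₀ hw)
    obtain ⟨s, hs⟩ := IsAlgClosed.exists_pow_nat_eq (-w) two_pos
    have h1 : ∀ z ∈ disc, z - w = s * b z * (s * b z) := by
      intro z hz
      calc z - w = s ^ 2 * b z ^ 2 := by rw [hs, (hb2 z hz).1]; field_simp; ring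
        _ = _ := by ring
    have h2 : ∀ z ∈ disc, ‖s * b z‖ ^ 2 ≤ ‖z - w‖ := by
      intro z hz
      rw [h1 z hz, norm_mul (s * b z), sq]
    refine ⟨Polynomial.X - Polynomial.C w, fun z => s * b z, fun z => s * b z, hb.const_mul s,
      hb.const_mul s, fun z hz => ⟨by simpa using h1 z hz, by simpa using h2 z hz,
        by simpa using h2 z hz⟩, fun _ _ => rfl⟩

theorem isSquareDominated (P : Polynomial ℂ) : IsSquareDominated P := by
  rw [(IsAlgClosed.splits P).eq_prod_roots]
  refine (isSquareDominated_C _).mul (Multiset.prod_induction _ _ (fun _ _ => .mul)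
    (by simpa using isSquareDominated_C 1) fun p hp => ?_)
  obtain ⟨w, -, rfl⟩ := Multiset.mem_map.1 hp
  exact isSquareDominated_X_sub_C w

/-- Bessel's inequality at radius ρ, then ρ → 1. The dominating Q is continuous up to the circle,
while nothing is known about a there. -/
theorem sum_sq_taylorCoeff_le_of_norm_sq_le {Q : Polynomial ℂ} {a : ℂ → ℂ}
    (ha : DifferentiableOn ℂ a disc) (hQ : ∀ z ∈ disc, ‖a z‖ ^ 2 ≤ ‖Q.eval z‖) (N : ℕ) :
    ∑ n ∈ Finset.range N, ‖taylorCoeff a n‖ ^ 2 ≤ ∫ ζ, ‖Q.eval ζ‖ ∂arcMeasure := by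
  have hc : Continuous fun z : ℂ => ‖Q.eval z‖ := Q.continuous.norm
  have h1 : Tendsto (fun ρ : ℝ => ∑ n ∈ Finset.range N, ‖taylorCoeff a n * (ρ : ℂ) ^ n‖ ^ 2)
      (𝓝[<] 1) (𝓝 (∑ n ∈ Finset.range N, ‖taylorCoeff a n‖ ^ 2)) := by
    have h := (Continuous.tendsto (f := fun ρ : ℝ => ∑ n ∈ Finset.range N,
      ‖taylorCoeff a n * (ρ : ℂ) ^ n‖ ^ 2) (by fun_prop) 1)
    simp only [Complex.ofReal_one, one_pow, mul_one] at h
    exact h.mono_left nhdsWithin_le_nhds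
  have h2 : Tendsto (fun ρ : ℝ => Real.circleAverage (fun z => ‖Q.eval z‖) 0 ρ) (𝓝[<] 1)
      (𝓝 (∫ ζ, ‖Q.eval ζ‖ ∂arcMeasure)) := by
    rw [integral_arcMeasure hc.aestronglyMeasurable]
    exact ((Real.Continuous.circleAverage hc).tendsto 1).mono_left nhdsWithin_le_nhds
  refine le_of_tendsto_of_tendsto h1 h2 ?_
  filter_upwards [Ioo_mem_nhdsLT (show (0 : ℝ) < 1 by norm_num)] with ρ hρ
  have hcρ : Continuous fun z : ℂ => ‖Q.eval (ρ * z)‖ := hc.comp (by fun_prop)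
  refine (sum_sq_taylorCoeff_le ha hρ N).trans ?_
  rw [Real.circleAverage_eq_circleAverage_zero_one]
  simp only [add_zero]
  rw [← integral_arcMeasure hcρ.aestronglyMeasurable]
  refine integral_mono_ae (integrable_of_continuousOn ((continuousOn_dilation ha hρ).norm.pow 2))
    (integrable_of_continuousOn hcρ.continuousOn) ?_
  filter_upwards [ae_norm_eq_one] with ζ hζ
  exact hQ _ (mem_disc.2 (norm_ofReal_mul_lt_one hρ hζ.le))

/-- A polynomial is the product of two analytic functions in the disc, the squares of the `H²`
norms of which are at most the `H¹` norm of the polynomial. -/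
theorem exists_taylorCoeff_factorization (P : Polynomial ℂ) : ∃ a b : ℕ → ℂ,
    (∀ N, ∑ n ∈ Finset.range N, ‖a n‖ ^ 2 ≤ ∫ ζ, ‖P.eval ζ‖ ∂arcMeasure) ∧
    (∀ N, ∑ n ∈ Finset.range N, ‖b n‖ ^ 2 ≤ ∫ ζ, ‖P.eval ζ‖ ∂arcMeasure) ∧
    ∀ n, P.coeff n = ∑ k ∈ Finset.range (n + 1), a k * b (n - k) := by
  obtain ⟨Q, a, b, ha, hb, hd, hc⟩ := isSquareDominated P
  have hI : ∫ ζ, ‖Q.eval ζ‖ ∂arcMeasure = ∫ ζ, ‖P.eval ζ‖ ∂arcMeasure := by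
    refine integral_congr_ae ?_
    filter_upwards [ae_norm_eq_one] with ζ hζ using hc ζ hζ
  rw [← hI]
  refine ⟨taylorCoeff a, taylorCoeff b,
    sum_sq_taylorCoeff_le_of_norm_sq_le ha fun z hz => (hd z hz).2.1,
    sum_sq_taylorCoeff_le_of_norm_sq_le hb fun z hz => (hd z hz).2.2, fun n => ?_⟩
  rw [← taylorCoeff_mul ha hb, ← taylorCoeff_polynomial]
  exact congrFun (taylorCoeff_congr fun z hz => (hd z hz).1) n

/-- A sequence of radii in `(0, 1)` that tends to `1`. -/
def radius (N : ℕ) : ℝ := 1 - 1 / ((N : ℝ) + 2)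

theorem radius_mem (N : ℕ) : radius N ∈ Ioo (0 : ℝ) 1 := by
  have h : (0 : ℝ) < (N : ℝ) + 2 := by positivity
  constructor
  · rw [radius, sub_pos, div_lt_one h]; linarith [(Nat.cast_nonneg N : (0 : ℝ) ≤ N)]
  · rw [radius]; linarith [show (0 : ℝ) < 1 / ((N : ℝ) + 2) by positivity]

theorem tendsto_radius_nhds : Tendsto radius atTop (𝓝 1) := by
  have h : Tendsto (fun N : ℕ => 1 / ((N : ℝ) + 2)) atTop (𝓝 0) := by
    refine Tendsto.div_atTop tendsto_const_nhds ?_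
    exact tendsto_atTop_add_const_right _ _ tendsto_natCast_atTop_atTop
  have h2 := h.const_sub 1
  rwa [sub_zero] at h2

theorem tendsto_radius : Tendsto radius atTop (𝓝[<] 1) :=
  tendsto_nhdsWithin_iff.2 ⟨tendsto_radius_nhds, Eventually.of_forall fun N => (radius_mem N).2⟩

/-- P is a Taylor polynomial of the dilation, of length L ≥ N so large that the remaining tail is
below 1 on the circle; this is the 1 in the bound. -/
theorem exists_polynomial_approx {h : ℂ → ℂ} (hd : DifferentiableOn ℂ h disc) {ρ : ℝ}
    (hρ : ρ ∈ Ioo (0 : ℝ) 1) (N : ℕ) : ∃ P : Polynomial ℂ,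
      (∀ n < N, P.coeff n = taylorCoeff h n * (ρ : ℂ) ^ n) ∧
      ∫ ζ, ‖P.eval ζ‖ ∂arcMeasure ≤ ∫ ζ, ‖h (ρ * ζ)‖ ∂arcMeasure + 1 := by
  have hs := summable_norm_taylorCoeff hd hρ
  have ht := (tendsto_sum_nat_add fun n => ‖taylorCoeff h n‖ * ρ ^ n)
  obtain ⟨L, hL, hNL⟩ := ((ht.eventually_lt_const one_pos).and (eventually_ge_atTop N)).exists
  set P : Polynomial ℂ := ∑ n ∈ Finset.range L,
    Polynomial.monomial n (taylorCoeff h n * (ρ : ℂ) ^ n) with hP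
  have hev : ∀ ζ, P.eval ζ = ∑ n ∈ Finset.range L, taylorCoeff h n * (ρ * ζ) ^ n := by
    intro ζ
    rw [hP, Polynomial.eval_finsetSum]
    refine Finset.sum_congr rfl fun n _ => ?_
    rw [Polynomial.eval_monomial, mul_pow, mul_assoc]
  refine ⟨P, fun n hn => ?_, ?_⟩
  · rw [hP, Polynomial.finsetSum_coeff]
    simp [Polynomial.coeff_monomial, show n < L by omega]
  · have hb : ∀ᵐ ζ ∂arcMeasure, ‖P.eval ζ‖ ≤ ‖h (ρ * ζ)‖ + 1 := by
      filter_upwards [ae_norm_eq_one] with ζ hζ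
      have h1 := hasSum_taylorCoeff hd (norm_ofReal_mul_lt_one hρ hζ.le)
      have h2 := h1.summable.sum_add_tsum_nat_add L
      rw [h1.tsum_eq, ← hev] at h2
      have h3 : ∀ n, ‖taylorCoeff h n * (ρ * ζ) ^ n‖ = ‖taylorCoeff h n‖ * ρ ^ n := fun n => by
        rw [norm_mul, norm_pow, norm_mul, hζ, Complex.norm_real, Real.norm_of_nonneg hρ.1.le,
          mul_one]
      have h4 : ‖∑' n, taylorCoeff h (n + L) * (ρ * ζ) ^ (n + L)‖ ≤ 1 := by
        refine (norm_tsum_le_tsum_norm ?_).trans ?_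
        · simp_rw [h3]
          exact (summable_nat_add_iff L).2 hs
        · simp_rw [h3]
          exact hL.le
      rw [← h2]
      calc ‖P.eval ζ‖ = ‖(P.eval ζ + ∑' n, taylorCoeff h (n + L) * (ρ * ζ) ^ (n + L)) -
            ∑' n, taylorCoeff h (n + L) * (ρ * ζ) ^ (n + L)‖ := by rw [add_sub_cancel_right]
        _ ≤ _ := (norm_sub_le _ _).trans (by gcongr)
    have hi : Integrable (fun ζ => ‖h (ρ * ζ)‖) arcMeasure :=
      integrable_of_continuousOn (continuousOn_dilation hd hρ).norm
    refine (integral_mono_ae (integrable_of_continuousOn P.continuous.norm.continuousOn)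
      (hi.add (integrable_const 1)) hb).trans_eq ?_
    rw [Pi.add_def, integral_add hi (integrable_const 1)]
    simp

/-- One ultrafilter serves all coefficients at once and replaces a diagonal subsequence. -/
theorem exists_tendsto_hyperfilter {a : ℕ → ℂ} {R : ℝ} (ha : ∀ N, ‖a N‖ ≤ R) :
    ∃ x, Tendsto a (hyperfilter ℕ) (𝓝 x) := by
  obtain ⟨x, -, hx⟩ := (isCompact_closedBall (0 : ℂ) R).ultrafilter_le_nhds
    ((hyperfilter ℕ).map a) (by
      rw [le_principal_iff]
      exact Eventually.of_forall (p := fun N => a N ∈ Metric.closedBall 0 R)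
        fun N => by simpa using ha N)
  exact ⟨x, hx⟩

/-- A function of the Hardy space `H¹` is the product of two functions of `H²`. -/
theorem exists_factorization {h : ℂ → ℂ} (hd : DifferentiableOn ℂ h disc) {C : ℝ}
    (hC : ∀ ρ ∈ Ioo (0 : ℝ) 1, ∫ ζ, ‖h (ρ * ζ)‖ ∂arcMeasure ≤ C) : ∃ a b : ℕ → ℂ,
    (Summable fun n => ‖a n‖ ^ 2) ∧ (Summable fun n => ‖b n‖ ^ 2) ∧
    ∀ z, ‖z‖ < 1 → h z = (∑' n, a n * z ^ n) * ∑' n, b n * z ^ n := by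
  choose P hPc hPi using fun N => exists_polynomial_approx hd (radius_mem N) N
  choose a b ha hb hab using fun N => exists_taylorCoeff_factorization (P N)
  have hC' : ∀ N, ∫ ζ, ‖(P N).eval ζ‖ ∂arcMeasure ≤ C + 1 := fun N =>
    (hPi N).trans (by linarith [hC _ (radius_mem N)])
  -- A uniform bound on finite sums of squares passes to the coefficientwise limit.
  have hlim : ∀ c : ℕ → ℕ → ℂ, (∀ N M, ∑ n ∈ Finset.range M, ‖c N n‖ ^ 2 ≤ C + 1) →
      ∃ x : ℕ → ℂ, (Summable fun n => ‖x n‖ ^ 2) ∧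
        ∀ n, Tendsto (fun N => c N n) (hyperfilter ℕ) (𝓝 (x n)) := by
    intro c hc
    have hbd : ∀ n N, ‖c N n‖ ≤ Real.sqrt (C + 1) := fun n N =>
      Real.le_sqrt_of_sq_le ((Finset.single_le_sum (f := fun n => ‖c N n‖ ^ 2)
        (fun _ _ => sq_nonneg _) (Finset.self_mem_range_succ n)).trans (hc N (n + 1)))
    choose x hx using fun n => exists_tendsto_hyperfilter (hbd n)
    refine ⟨x, summable_of_sum_range_le (c := C + 1) (fun _ => sq_nonneg _) fun M => ?_, hx⟩
    exact le_of_tendsto' (tendsto_finsetSum _ fun n _ => (hx n).norm.pow 2) fun N => hc N M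
  obtain ⟨x, hxs, hx⟩ := hlim a fun N M => (ha N M).trans (hC' N)
  obtain ⟨y, hys, hy⟩ := hlim b fun N M => (hb N M).trans (hC' N)
  refine ⟨x, y, hxs, hys, fun z hz => ?_⟩
  -- Each coefficient of a product is a finite sum, so coefficientwise convergence is enough.
  have hcoeff : ∀ n, taylorCoeff h n = ∑ k ∈ Finset.range (n + 1), x k * y (n - k) := by
    intro n
    have h1 : Tendsto (fun N => (P N).coeff n) (hyperfilter ℕ) (𝓝 (taylorCoeff h n)) := by
      refine Tendsto.mono_left ?_ Nat.hyperfilter_le_atTop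
      have h2 : Tendsto (fun N => taylorCoeff h n * (radius N : ℂ) ^ n) atTop
          (𝓝 (taylorCoeff h n * ((1 : ℝ) : ℂ) ^ n)) :=
        (((Complex.continuous_ofReal.tendsto 1).comp tendsto_radius_nhds).pow n).const_mul _
      simp only [Complex.ofReal_one, one_pow, mul_one] at h2
      refine h2.congr' ?_
      filter_upwards [eventually_gt_atTop n] with N hN using (hPc N n hN).symm
    refine tendsto_nhds_unique h1 ?_
    simp_rw [hab]
    exact tendsto_finsetSum _ fun k _ => (hx k).mul (hy (n - k))
  obtain ⟨Cx, hCx⟩ := exists_norm_le_of_summable_sq hxs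
  obtain ⟨Cy, hCy⟩ := exists_norm_le_of_summable_sq hys
  rw [tsum_mul_tsum_eq_tsum_sum_range_of_summable_norm (summable_norm_mul_pow hCx hz)
    (summable_norm_mul_pow hCy hz), ← (hasSum_taylorCoeff hd hz).tsum_eq]
  refine tsum_congr fun n => ?_
  rw [hcoeff, Finset.sum_mul]
  refine Finset.sum_congr rfl fun k hk => ?_
  have hkn : k ≤ n := Nat.lt_succ_iff.1 (Finset.mem_range.1 hk)
  rw [← pow_mul_pow_sub z hkn]
  ring

/-! ### Boundary functions and Cauchy's formula in H¹. -/

theorem hardyNorm_one (h : ℂ → ℂ) :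
    hardyNorm 1 h = ⨆ r ∈ Ioo (0 : ℝ) 1, ∫⁻ ζ, ‖h (r * ζ)‖ₑ ∂arcMeasure := by
  simp [hardyNorm]

theorem hardyNorm_top (h : ℂ → ℂ) : hardyNorm ∞ h = ⨆ z ∈ disc, ‖h z‖ₑ := by
  simp [hardyNorm]

theorem lintegral_le_hardyNorm_one (h : ℂ → ℂ) {r : ℝ} (hr : r ∈ Ioo (0 : ℝ) 1) :
    ∫⁻ ζ, ‖h (r * ζ)‖ₑ ∂arcMeasure ≤ hardyNorm 1 h := by
  rw [hardyNorm_one]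
  exact le_iSup₂ (f := fun r (_ : r ∈ Ioo (0 : ℝ) 1) => ∫⁻ ζ, ‖h (r * ζ)‖ₑ ∂arcMeasure) r hr

theorem enorm_le_hardyNorm_top (h : ℂ → ℂ) {z : ℂ} (hz : ‖z‖ < 1) : ‖h z‖ₑ ≤ hardyNorm ∞ h := by
  rw [hardyNorm_top]
  exact le_iSup₂ (f := fun z (_ : z ∈ disc) => ‖h z‖ₑ) z (mem_disc.2 hz)

theorem hardyNorm_one_le_top (h : ℂ → ℂ) : hardyNorm 1 h ≤ hardyNorm ∞ h := by
  rw [hardyNorm_one]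
  refine iSup₂_le fun r hr => ?_
  calc _ ≤ ∫⁻ _, hardyNorm ∞ h ∂arcMeasure := by
        refine lintegral_mono_ae ?_
        filter_upwards [ae_norm_eq_one] with ζ hζ
        exact enorm_le_hardyNorm_top h (norm_ofReal_mul_lt_one hr hζ.le)
    _ = _ := by simp

theorem hardySpace_top_subset_one : hardySpace ∞ ⊆ hardySpace 1 := fun h hh =>
  ⟨hh.1, (hardyNorm_one_le_top h).trans_lt hh.2⟩

theorem exists_boundary_of_mem_hardySpace_one {h : ℂ → ℂ} (hh : h ∈ hardySpace 1) :
    ∃ Φ : ℂ → ℂ, Integrable Φ arcMeasure ∧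
      (∀ᵐ η ∂arcMeasure, Tendsto (fun r : ℝ => h (r * η)) (𝓝[<] 1) (𝓝 (Φ η))) ∧
      ∀ z, ‖z‖ < 1 → ∫ ζ, Φ ζ / (1 - conj ζ * z) ∂arcMeasure = h z := by
  obtain ⟨a, b, ha, hb, hab⟩ := exists_factorization hh.1 (C := (hardyNorm 1 h).toReal) (by
    intro ρ hρ
    rw [integral_norm_eq_lintegral_enorm
      (aestronglyMeasurable_of_continuousOn (continuousOn_dilation hh.1 hρ))]
    exact ENNReal.toReal_mono hh.2.ne (lintegral_le_hardyNorm_one h hρ))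
  obtain ⟨Φ, hΦ, hlim, hint⟩ := exists_boundary_of_summable_sq_mul ha hb
  refine ⟨Φ, hΦ, ?_, fun z hz => by rw [hint z hz, hab z hz]⟩
  filter_upwards [hlim, ae_norm_eq_one] with η h1 h2
  refine h1.congr' ?_
  filter_upwards [Ioo_mem_nhdsLT (show (0 : ℝ) < 1 by norm_num)] with r hr
  exact (hab _ (norm_ofReal_mul_lt_one hr h2.le)).symm

/-- Functions of `H¹` have radial limits almost everywhere. -/
theorem ae_tendsto_boundaryValue {h : ℂ → ℂ} (hh : h ∈ hardySpace 1) :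
    ∀ᵐ η ∂arcMeasure, Tendsto (fun r : ℝ => h (r * η)) (𝓝[<] 1) (𝓝 (boundaryValue h η)) := by
  obtain ⟨Φ, -, hlim, -⟩ := exists_boundary_of_mem_hardySpace_one hh
  filter_upwards [hlim] with η hη using tendsto_nhds_limUnder ⟨_, hη⟩

theorem integrable_boundaryValue_and_cauchy {h : ℂ → ℂ} (hh : h ∈ hardySpace 1) :
    Integrable (boundaryValue h) arcMeasure ∧
      ∀ z, ‖z‖ < 1 → ∫ ζ, boundaryValue h ζ / (1 - conj ζ * z) ∂arcMeasure = h z := by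
  obtain ⟨Φ, hΦ, hlim, hint⟩ := exists_boundary_of_mem_hardySpace_one hh
  have hae : Φ =ᵐ[arcMeasure] boundaryValue h := by
    filter_upwards [hlim, ae_tendsto_boundaryValue hh] with η h1 h2 using tendsto_nhds_unique h1 h2
  refine ⟨hΦ.congr hae, fun z hz => ?_⟩
  rw [← hint z hz]
  refine integral_congr_ae ?_
  filter_upwards [hae] with ζ hζ
  rw [hζ]

theorem integrable_boundaryValue {h : ℂ → ℂ} (hh : h ∈ hardySpace 1) :
    Integrable (boundaryValue h) arcMeasure :=
  (integrable_boundaryValue_and_cauchy hh).1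

theorem integral_boundaryValue_cauchy {h : ℂ → ℂ} (hh : h ∈ hardySpace 1) {z : ℂ} (hz : ‖z‖ < 1) :
    ∫ ζ, boundaryValue h ζ / (1 - conj ζ * z) ∂arcMeasure = h z :=
  (integrable_boundaryValue_and_cauchy hh).2 z hz

/-- Fatou's lemma along the radii `radius N`. -/
theorem lintegral_boundaryValue_le {h : ℂ → ℂ} (hh : h ∈ hardySpace 1) :
    ∫⁻ ζ, ‖boundaryValue h ζ‖ₑ ∂arcMeasure ≤ hardyNorm 1 h := by
  calc _ = ∫⁻ ζ, liminf (fun N => ‖h (radius N * ζ)‖ₑ) atTop ∂arcMeasure := by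
        refine lintegral_congr_ae ?_
        filter_upwards [ae_tendsto_boundaryValue hh] with ζ hζ
        exact ((hζ.comp tendsto_radius).enorm).liminf_eq.symm
    _ ≤ liminf (fun N => ∫⁻ ζ, ‖h (radius N * ζ)‖ₑ ∂arcMeasure) atTop :=
        lintegral_liminf_le' fun N => (aestronglyMeasurable_of_continuousOn
          (continuousOn_dilation hh.1 (radius_mem N))).enorm
    _ ≤ liminf (fun _ : ℕ => hardyNorm 1 h) atTop :=
        liminf_le_liminf (Eventually.of_forall fun N =>
          lintegral_le_hardyNorm_one h (radius_mem N))
    _ = _ := by simp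

theorem ae_enorm_boundaryValue_le {h : ℂ → ℂ} (hh : h ∈ hardySpace ∞) :
    ∀ᵐ ζ ∂arcMeasure, ‖boundaryValue h ζ‖ₑ ≤ hardyNorm ∞ h := by
  filter_upwards [ae_tendsto_boundaryValue (hardySpace_top_subset_one hh), ae_norm_eq_one]
    with ζ h1 h2
  refine le_of_tendsto h1.enorm ?_
  filter_upwards [Ioo_mem_nhdsLT (show (0 : ℝ) < 1 by norm_num)] with r hr
  exact enorm_le_hardyNorm_top h (norm_ofReal_mul_lt_one hr h2.le)

/-! ### Toeplitz operators with symbol in 𝔑. -/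

theorem integrable_conj_boundaryValue_mul {g : ℂ → ℂ} (hg : g ∈ hardySpace ∞) {φ : ℂ → ℂ}
    (hφ : Integrable φ arcMeasure) :
    Integrable (fun ζ => conj (boundaryValue g ζ) * φ ζ) arcMeasure := by
  have hgm := (integrable_boundaryValue (hardySpace_top_subset_one hg)).aestronglyMeasurable
  refine hφ.bdd_mul (c := (hardyNorm ∞ g).toReal)
    (Complex.continuous_conj.comp_aestronglyMeasurable hgm) ?_
  filter_upwards [ae_enorm_boundaryValue_le hg] with ζ hζ
  rw [RCLike.norm_conj, ← toReal_enorm]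
  exact ENNReal.toReal_mono hg.2.ne hζ

theorem integrable_div_one_sub_conj_mul {φ : ℂ → ℂ} (hφ : Integrable φ arcMeasure) {z : ℂ}
    (hz : ‖z‖ < 1) : Integrable (fun ζ => φ ζ / (1 - conj ζ * z)) arcMeasure := by
  simp_rw [div_eq_inv_mul]
  exact integrable_mul_of_continuousOn hφ (continuousOn_inv_one_sub_conj_mul hz)

theorem integrable_toeplitz {g h : ℂ → ℂ} (hg : g ∈ hardySpace ∞) (hh : h ∈ hardySpace 1) {z : ℂ}
    (hz : ‖z‖ < 1) : Integrable (fun ζ =>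
      conj (boundaryValue g ζ) * boundaryValue h ζ / (1 - conj ζ * z)) arcMeasure :=
  integrable_div_one_sub_conj_mul
    (integrable_conj_boundaryValue_mul hg (integrable_boundaryValue hh)) hz

theorem differentiableOn_toeplitz {g h : ℂ → ℂ} (hg : g ∈ hardySpace ∞) (hh : h ∈ hardySpace 1) :
    DifferentiableOn ℂ (toeplitz g h) disc :=
  differentiableOn_cauchyTransform
    (integrable_conj_boundaryValue_mul hg (integrable_boundaryValue hh))

/-- From |ζ - ρη|² = (1 - ρ)² + ρ|ζ - η|² the first term is dropped. -/
theorem inv_enorm_one_sub_conj_mul_le {ζ η : ℂ} (hζ : ‖ζ‖ = 1) (hη : ‖η‖ = 1) {ρ : ℝ}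
    (hρ : ρ ∈ Ioo (0 : ℝ) 1) :
    ‖1 - conj ζ * (ρ * η)‖ₑ⁻¹ ≤ (ENNReal.ofReal (Real.sqrt ρ))⁻¹ * ‖ζ - η‖ₑ⁻¹ := by
  have h0 : 0 < Real.sqrt ρ := Real.sqrt_pos.2 hρ.1
  rw [← ENNReal.mul_inv (Or.inl (by simpa using hρ.1)) (Or.inl ENNReal.ofReal_ne_top)]
  refine ENNReal.inv_le_inv.2 ?_
  rw [← ofReal_norm, ← ofReal_norm, ← ENNReal.ofReal_mul h0.le, norm_one_sub_conj_mul hζ]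
  refine ENNReal.ofReal_le_ofReal ((sq_le_sq₀ (by positivity) (norm_nonneg _)).1 ?_)
  rw [mul_pow, Real.sq_sqrt hρ.1.le, norm_sub_smul_sq hζ hη]
  linarith [sq_nonneg (1 - ρ)]

/-- The modulus of the difference quotient of the boundary function. -/
def diffQuot (g : ℂ → ℂ) (ζ η : ℂ) : ℝ≥0∞ :=
  ‖boundaryValue g ζ - boundaryValue g η‖ₑ / ‖ζ - η‖ₑ

theorem diffQuot_comm (g : ℂ → ℂ) (ζ η : ℂ) : diffQuot g ζ η = diffQuot g η ζ := by
  rw [diffQuot, diffQuot, enorm_sub_rev, enorm_sub_rev ζ]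

theorem ae_lintegral_diffQuot_le (g : ℂ → ℂ) :
    ∀ᵐ η ∂arcMeasure, ∫⁻ ζ, diffQuot g ζ η ∂arcMeasure ≤ lam g :=
  ENNReal.ae_le_essSup _

theorem aemeasurable_diffQuot_mul {g : ℂ → ℂ} (hg : g ∈ hardySpace 1) {φ : ℂ → ℂ}
    (hφ : Integrable φ arcMeasure) :
    AEMeasurable (fun x : ℂ × ℂ => diffQuot g x.2 x.1 * ‖φ x.2‖ₑ)
      (arcMeasure.prod arcMeasure) := by
  have hgm := (integrable_boundaryValue hg).aestronglyMeasurable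
  have h1 := (hgm.comp_snd (μ := arcMeasure)).sub (hgm.comp_fst (ν := arcMeasure))
  have h2 : Measurable fun x : ℂ × ℂ => ‖x.2 - x.1‖ₑ := by fun_prop
  exact (h1.enorm.div h2.aemeasurable).mul (hφ.aestronglyMeasurable.comp_snd).enorm

theorem enorm_toeplitz_le {g h : ℂ → ℂ} (hg : g ∈ hardySpace ∞) (hh : h ∈ hardySpace 1) {ρ : ℝ}
    (hρ : ρ ∈ Ioo (0 : ℝ) 1) : ∀ᵐ η ∂arcMeasure, ‖toeplitz g h (ρ * η)‖ₑ ≤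
      hardyNorm ∞ g * ‖h (ρ * η)‖ₑ + (ENNReal.ofReal (Real.sqrt ρ))⁻¹ *
        ∫⁻ ζ, diffQuot g ζ η * ‖boundaryValue h ζ‖ₑ ∂arcMeasure := by
  filter_upwards [ae_norm_eq_one, ae_enorm_boundaryValue_le hg] with η hη hgη
  have hz := norm_ofReal_mul_lt_one hρ hη.le
  -- Subtracting the constant conj g(η) from the symbol costs a Cauchy integral of h and leaves a
  -- difference that compensates the singular kernel.
  have hsplit : toeplitz g h (ρ * η) = conj (boundaryValue g η) * h (ρ * η) +
      ∫ ζ, (conj (boundaryValue g ζ - boundaryValue g η) * boundaryValue h ζ) /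
        (1 - conj ζ * (ρ * η)) ∂arcMeasure := by
    rw [← integral_boundaryValue_cauchy hh hz, ← integral_const_mul, ← integral_add]
    · refine integral_congr_ae (Eventually.of_forall fun ζ => ?_)
      simp only [map_sub]
      ring
    · exact (integrable_div_one_sub_conj_mul (integrable_boundaryValue hh) hz).const_mul _
    · refine integrable_div_one_sub_conj_mul ?_ hz
      simp only [map_sub, sub_mul]
      exact (integrable_conj_boundaryValue_mul hg (integrable_boundaryValue hh)).sub
        ((integrable_boundaryValue hh).const_mul _)
  rw [hsplit]
  refine (enorm_add_le _ _).trans (add_le_add ?_ ?_)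
  · rw [enorm_mul]
    refine mul_le_mul' (le_of_eq_of_le ?_ hgη) le_rfl
    rw [← ofReal_norm, ← ofReal_norm, RCLike.norm_conj]
  · refine (enorm_integral_le_lintegral_enorm _).trans ?_
    rw [← lintegral_const_mul' _ _ (ENNReal.inv_ne_top.2 (by simpa using hρ.1))]
    refine lintegral_mono_ae ?_
    filter_upwards [ae_norm_eq_one] with ζ hζ
    have h1 : ‖conj (boundaryValue g ζ - boundaryValue g η)‖ₑ =
        ‖boundaryValue g ζ - boundaryValue g η‖ₑ := by
      rw [← ofReal_norm, ← ofReal_norm, RCLike.norm_conj]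
    rw [div_eq_mul_inv, enorm_mul, enorm_mul, h1, enorm_inv (one_sub_conj_mul_ne_zero hz hζ)]
    refine (mul_le_mul' le_rfl (inv_enorm_one_sub_conj_mul_le hζ hη hρ)).trans_eq ?_
    rw [diffQuot, div_eq_mul_inv]
    ring

/-- Removes the factor ρ^(-1/2). As C may be ∞, the case A + L = 0, where multiplication fails to be
continuous, is separate; there both sides vanish. -/
theorem tendsto_inv_sqrt_bound {A L C : ℝ≥0∞} (hA : A ≠ ∞) (hL : L ≠ ∞) :
    Tendsto (fun ρ : ℝ => (A + (ENNReal.ofReal (Real.sqrt ρ))⁻¹ * L) * C) (𝓝[<] 1)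
      (𝓝 ((A + L) * C)) := by
  have h1 : Tendsto (fun ρ : ℝ => (ENNReal.ofReal (Real.sqrt ρ))⁻¹) (𝓝[<] 1) (𝓝 1) := by
    have h2 : Tendsto (fun ρ : ℝ => ENNReal.ofReal (Real.sqrt ρ)) (𝓝 1)
        (𝓝 (ENNReal.ofReal (Real.sqrt 1))) :=
      ENNReal.tendsto_ofReal (Real.continuous_sqrt.tendsto 1)
    simpa using (tendsto_inv_iff.2 h2).mono_left nhdsWithin_le_nhds
  have h3 : Tendsto (fun ρ : ℝ => A + (ENNReal.ofReal (Real.sqrt ρ))⁻¹ * L) (𝓝[<] 1)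
      (𝓝 (A + 1 * L)) :=
    tendsto_const_nhds.add (ENNReal.Tendsto.mul_const h1 (Or.inr hL))
  rw [one_mul] at h3
  rcases eq_or_ne (A + L) 0 with h0 | h0
  · obtain ⟨rfl, rfl⟩ := add_eq_zero.1 h0
    simp
  · exact ENNReal.Tendsto.mul_const h3 (Or.inl h0)

theorem hardyNorm_top_toeplitz_le {g h : ℂ → ℂ} (hg : g ∈ classN) (hh : h ∈ hardySpace ∞) :
    hardyNorm ∞ (toeplitz g h) ≤ normN g * hardyNorm ∞ h := by
  have hh1 := hardySpace_top_subset_one hh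
  rw [hardyNorm_top]
  refine iSup₂_le fun z hz => ?_
  rw [mem_disc] at hz
  refine ge_of_tendsto (tendsto_inv_sqrt_bound hg.1.2.ne hg.2.ne) ?_
  filter_upwards [Ioo_mem_nhdsLT (show max ‖z‖ 0 < 1 by simpa using hz)] with ρ hρ
  have hρ' : ρ ∈ Ioo (0 : ℝ) 1 := ⟨(le_max_right _ _).trans_lt hρ.1, hρ.2⟩
  have hzρ : ‖z‖ < ρ := (le_max_left _ _).trans_lt hρ.1
  set w : ℂ := z / ρ with hw
  have hρ0 : (ρ : ℂ) ≠ 0 := by exact_mod_cast hρ'.1.ne'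
  have hw1 : ‖w‖ < 1 := by
    rwa [hw, norm_div, Complex.norm_real, Real.norm_of_nonneg hρ'.1.le, div_lt_one hρ'.1]
  have hzw : z = ρ * w := by rw [hw]; field_simp
  rw [hzw]
  -- The estimate on the circle of radius ρ holds only almost everywhere, so the value at z is
  -- reached by a Poisson average.
  refine (enorm_le_lintegral_poissonKernel (differentiableOn_toeplitz hg.1 hh1) hρ' hw1).trans ?_
  calc _ ≤ ∫⁻ ζ, ENNReal.ofReal (poissonKernel 0 w ζ) *
        ((hardyNorm ∞ g + (ENNReal.ofReal (Real.sqrt ρ))⁻¹ * lam g) * hardyNorm ∞ h)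
          ∂arcMeasure := by
        refine lintegral_mono_ae ?_
        filter_upwards [enorm_toeplitz_le hg.1 hh1 hρ', ae_norm_eq_one, ae_lintegral_diffQuot_le g]
          with η h1 h2 h3
        refine mul_le_mul' le_rfl (h1.trans ?_)
        rw [add_mul, mul_assoc]
        refine add_le_add (mul_le_mul' le_rfl (enorm_le_hardyNorm_top h
          (norm_ofReal_mul_lt_one hρ' h2.le))) (mul_le_mul' le_rfl ?_)
        calc _ ≤ ∫⁻ ζ, diffQuot g ζ η * hardyNorm ∞ h ∂arcMeasure := by
              refine lintegral_mono_ae ?_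
              filter_upwards [ae_enorm_boundaryValue_le hh] with ζ hζ
              exact mul_le_mul' le_rfl hζ
          _ = (∫⁻ ζ, diffQuot g ζ η ∂arcMeasure) * hardyNorm ∞ h :=
              lintegral_mul_const' _ _ hh.2.ne
          _ ≤ _ := mul_le_mul' h3 le_rfl
    _ = _ := by
        rw [lintegral_mul_const'' _ (aestronglyMeasurable_of_continuousOn
          (continuousOn_poissonKernel hw1)).aemeasurable.ennreal_ofReal,
          lintegral_poissonKernel hw1, one_mul]

/-- The integral means of an analytic function increase with the radius. -/
theorem lintegral_enorm_mono {u : ℂ → ℂ} (hu : DifferentiableOn ℂ u disc) {r ρ : ℝ} (hr : 0 < r)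
    (hrρ : r < ρ) (hρ : ρ < 1) :
    ∫⁻ η, ‖u (r * η)‖ₑ ∂arcMeasure ≤ ∫⁻ ζ, ‖u (ρ * ζ)‖ₑ ∂arcMeasure := by
  have hρ0 : 0 < ρ := hr.trans hrρ
  have hs : r / ρ ∈ Ioo (0 : ℝ) 1 := ⟨div_pos hr hρ0, (div_lt_one hρ0).2 hrρ⟩
  have hm : AEMeasurable (fun ζ => ‖u (ρ * ζ)‖ₑ) arcMeasure :=
    (aestronglyMeasurable_of_continuousOn (continuousOn_dilation hu ⟨hρ0, hρ⟩)).enorm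
  calc _ ≤ ∫⁻ η, ∫⁻ ζ, ENNReal.ofReal (poissonKernel 0 ((r / ρ : ℝ) * η) ζ) * ‖u (ρ * ζ)‖ₑ
        ∂arcMeasure ∂arcMeasure := by
        refine lintegral_mono_ae ?_
        filter_upwards [ae_norm_eq_one] with η hη
        have h1 : (r : ℂ) * η = ρ * ((r / ρ : ℝ) * η) := by
          have : (ρ : ℂ) ≠ 0 := by exact_mod_cast hρ0.ne'
          push_cast
          field_simp
        rw [h1]
        exact enorm_le_lintegral_poissonKernel hu ⟨hρ0, hρ⟩ (norm_smul_lt_one hη hs)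
    _ = ∫⁻ ζ, ∫⁻ η, ENNReal.ofReal (poissonKernel 0 ((r / ρ : ℝ) * η) ζ) * ‖u (ρ * ζ)‖ₑ
        ∂arcMeasure ∂arcMeasure := by
        refine lintegral_lintegral_swap ?_
        refine AEMeasurable.mul ?_ (hm.comp_quasiMeasurePreserving
          Measure.quasiMeasurePreserving_snd)
        simp only [poissonKernel_zero_eq]
        exact Measurable.aemeasurable (by fun_prop)
    _ = _ := by
        refine lintegral_congr_ae ?_
        filter_upwards [ae_norm_eq_one] with ζ hζ
        rw [lintegral_mul_const'' _ (by
          simp only [poissonKernel_zero_eq]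
          exact Measurable.aemeasurable (by fun_prop))]
        -- For unit ζ, η the kernel at radius r/ρ is symmetric, so it also has mass one in η.
        have h2 : ∫⁻ η, ENNReal.ofReal (poissonKernel 0 ((r / ρ : ℝ) * η) ζ) ∂arcMeasure = 1 := by
          rw [← lintegral_poissonKernel (norm_smul_lt_one hζ hs)]
          refine lintegral_congr_ae ?_
          filter_upwards [ae_norm_eq_one] with η hη
          rw [poissonKernel_zero_eq, poissonKernel_zero_eq, norm_sub_smul_sq hζ hη,
            norm_sub_smul_sq hη hζ, norm_mul, norm_mul, hζ, hη, norm_sub_rev]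
        rw [h2, one_mul]

theorem hardyNorm_one_toeplitz_le {g h : ℂ → ℂ} (hg : g ∈ classN) (hh : h ∈ hardySpace 1) :
    hardyNorm 1 (toeplitz g h) ≤ normN g * hardyNorm 1 h := by
  have hg1 := hardySpace_top_subset_one hg.1
  rw [hardyNorm_one]
  refine iSup₂_le fun r hr => ?_
  refine ge_of_tendsto (tendsto_inv_sqrt_bound hg.1.2.ne hg.2.ne) ?_
  -- The mean over radius r is compared with those over larger ρ → 1, where ρ^(-1/2) disappears.
  filter_upwards [Ioo_mem_nhdsLT hr.2] with ρ hρ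
  have hρ' : ρ ∈ Ioo (0 : ℝ) 1 := ⟨hr.1.trans hρ.1, hρ.2⟩
  refine (lintegral_enorm_mono (differentiableOn_toeplitz hg.1 hh) hr.1 hρ.1 hρ.2).trans ?_
  have hm : AEMeasurable (fun ζ => ‖h (ρ * ζ)‖ₑ) arcMeasure :=
    (aestronglyMeasurable_of_continuousOn (continuousOn_dilation hh.1 hρ')).enorm
  have hswap : ∫⁻ η, ∫⁻ ζ, diffQuot g ζ η * ‖boundaryValue h ζ‖ₑ ∂arcMeasure ∂arcMeasure ≤
      lam g * hardyNorm 1 h := by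
    -- After the exchange the inner integral is over η; symmetry of `diffQuot` makes it the one
    -- bounded by Λ(g).
    rw [lintegral_lintegral_swap (aemeasurable_diffQuot_mul hg1 (integrable_boundaryValue hh))]
    calc _ ≤ ∫⁻ ζ, lam g * ‖boundaryValue h ζ‖ₑ ∂arcMeasure := by
          refine lintegral_mono_ae ?_
          filter_upwards [ae_lintegral_diffQuot_le g] with ζ hζ
          rw [lintegral_mul_const' _ _ enorm_ne_top]
          simp_rw [diffQuot_comm g ζ]
          exact mul_le_mul' hζ le_rfl
      _ = lam g * ∫⁻ ζ, ‖boundaryValue h ζ‖ₑ ∂arcMeasure := lintegral_const_mul' _ _ hg.2.ne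
      _ ≤ _ := mul_le_mul' le_rfl (lintegral_boundaryValue_le hh)
  calc _ ≤ ∫⁻ η, (hardyNorm ∞ g * ‖h (ρ * η)‖ₑ + (ENNReal.ofReal (Real.sqrt ρ))⁻¹ *
        ∫⁻ ζ, diffQuot g ζ η * ‖boundaryValue h ζ‖ₑ ∂arcMeasure) ∂arcMeasure :=
        lintegral_mono_ae (enorm_toeplitz_le hg.1 hh hρ')
    _ = hardyNorm ∞ g * ∫⁻ η, ‖h (ρ * η)‖ₑ ∂arcMeasure + (ENNReal.ofReal (Real.sqrt ρ))⁻¹ *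
        ∫⁻ η, ∫⁻ ζ, diffQuot g ζ η * ‖boundaryValue h ζ‖ₑ ∂arcMeasure ∂arcMeasure := by
        rw [lintegral_add_left' (hm.const_mul _), lintegral_const_mul' _ _ hg.1.2.ne,
          lintegral_const_mul' _ _ (ENNReal.inv_ne_top.2 (by simpa using hρ'.1))]
    _ ≤ hardyNorm ∞ g * hardyNorm 1 h + (ENNReal.ofReal (Real.sqrt ρ))⁻¹ *
        (lam g * hardyNorm 1 h) :=
        add_le_add (mul_le_mul' le_rfl (lintegral_le_hardyNorm_one h hρ'))
          (mul_le_mul' le_rfl hswap)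
    _ = _ := by ring

theorem normN_lt_top {g : ℂ → ℂ} (hg : g ∈ classN) : normN g < ∞ :=
  ENNReal.add_lt_top.2 ⟨hg.1.2, hg.2⟩

theorem hardyNorm_toeplitz_le {g h : ℂ → ℂ} (hg : g ∈ classN) {p : ℝ≥0∞} (hp : p = 1 ∨ p = ∞)
    (hh : h ∈ hardySpace p) : hardyNorm p (toeplitz g h) ≤ normN g * hardyNorm p h := by
  rcases hp with rfl | rfl
  · exact hardyNorm_one_toeplitz_le hg hh
  · exact hardyNorm_top_toeplitz_le hg hh

theorem opNorm_toeplitz_le {g : ℂ → ℂ} (hg : g ∈ classN) {p : ℝ≥0∞} (hp : p = 1 ∨ p = ∞) :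
    opNorm p (toeplitz g) ≤ normN g := by
  refine iSup₂_le fun h hh => (hardyNorm_toeplitz_le hg hp hh.1).trans ?_
  calc _ ≤ normN g * 1 := mul_le_mul' le_rfl hh.2
    _ = _ := mul_one _

theorem boundaryValue_add_ae {h₁ h₂ : ℂ → ℂ} (hh₁ : h₁ ∈ hardySpace 1) (hh₂ : h₂ ∈ hardySpace 1) :
    ∀ᵐ ζ ∂arcMeasure,
      boundaryValue (h₁ + h₂) ζ = boundaryValue h₁ ζ + boundaryValue h₂ ζ := by
  filter_upwards [ae_tendsto_boundaryValue hh₁, ae_tendsto_boundaryValue hh₂] with ζ e₁ e₂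
  exact (e₁.add e₂).limUnder_eq

theorem boundaryValue_smul_ae (c : ℂ) {h : ℂ → ℂ} (hh : h ∈ hardySpace 1) :
    ∀ᵐ ζ ∂arcMeasure, boundaryValue (c • h) ζ = c * boundaryValue h ζ := by
  filter_upwards [ae_tendsto_boundaryValue hh] with ζ e
  exact (e.const_mul c).limUnder_eq

theorem toeplitzBounded {g : ℂ → ℂ} (hg : g ∈ classN) {p : ℝ≥0∞} (hp : p = 1 ∨ p = ∞) :
    ToeplitzBounded p g := by
  have hsub : ∀ h ∈ hardySpace p, h ∈ hardySpace 1 := by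
    rcases hp with rfl | rfl
    · exact fun _ => id
    · exact fun _ h => hardySpace_top_subset_one h
  refine ⟨fun h hh z hz => integrable_toeplitz hg.1 (hsub h hh) (mem_disc.1 hz), ?_⟩
  refine ⟨fun h hh => ⟨differentiableOn_toeplitz hg.1 (hsub h hh), ?_⟩,
    fun h₁ hh₁ h₂ hh₂ z hz => ?_, fun c h hh z hz => ?_,
    (opNorm_toeplitz_le hg hp).trans_lt (normN_lt_top hg)⟩
  · exact (hardyNorm_toeplitz_le hg hp hh).trans_lt (ENNReal.mul_lt_top (normN_lt_top hg) hh.2)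
  · rw [Pi.add_apply, toeplitz, toeplitz, toeplitz,
      ← integral_add (integrable_toeplitz hg.1 (hsub h₁ hh₁) (mem_disc.1 hz))
        (integrable_toeplitz hg.1 (hsub h₂ hh₂) (mem_disc.1 hz))]
    refine integral_congr_ae ?_
    filter_upwards [boundaryValue_add_ae (hsub h₁ hh₁) (hsub h₂ hh₂)] with ζ hζ
    rw [hζ]
    ring
  · rw [Pi.smul_apply, smul_eq_mul, toeplitz, toeplitz, ← integral_const_mul]
    refine integral_congr_ae ?_
    filter_upwards [boundaryValue_smul_ae c (hsub h hh)] with ζ hζ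
    rw [hζ]
    ring

/-! ### Convex null sequences as mixtures of triangles. -/

/-- A positive limit would make the series dominate a multiple of the harmonic series. -/
theorem tendsto_zero_of_summable_div {α : ℕ → ℝ} (hpos : ∀ n, 0 < α n) (hanti : Antitone α)
    (hsum : Summable fun n : ℕ => α n / ((n : ℝ) + 1)) : Tendsto α atTop (𝓝 0) := by
  have hbdd : BddBelow (range α) := ⟨0, by rintro _ ⟨n, rfl⟩; exact (hpos n).le⟩
  have ht := tendsto_atTop_ciInf hanti hbdd
  have hL0 : 0 ≤ ⨅ n, α n := le_ciInf fun n => (hpos n).le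
  rcases hL0.eq_or_lt with h | h
  · rwa [← h] at ht
  · exfalso
    have h1 : Summable fun n : ℕ => (⨅ n, α n) * (1 / ((n : ℝ) + 1)) := by
      refine Summable.of_nonneg_of_le (fun n => by positivity) (fun n => ?_) hsum
      rw [mul_one_div]
      gcongr
      exact ciInf_le hbdd n
    have h2 := (summable_mul_left_iff h.ne').1 h1
    have h3 : Summable fun n : ℕ => 1 / ((n + 1 : ℕ) : ℝ) := by simpa using h2
    exact Real.not_summable_one_div_natCast ((summable_nat_add_iff 1).1 h3)

theorem tsum_ite_sub_eq {β : ℕ → ℝ} (hβ : Antitone β) (h0 : Tendsto β atTop (𝓝 0)) (n : ℕ) :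
    ∑' k, (if n ≤ k then ENNReal.ofReal (β k - β (k + 1)) else 0) = ENNReal.ofReal (β n) := by
  have hs : ∀ N, n ≤ N → ∑ k ∈ Finset.range N,
      (if n ≤ k then ENNReal.ofReal (β k - β (k + 1)) else 0) = ENNReal.ofReal (β n - β N) := by
    intro N hN
    induction N, hN using Nat.le_induction with
    | base =>
      rw [sub_self, ENNReal.ofReal_zero]
      refine Finset.sum_eq_zero fun k hk => if_neg ?_
      have := Finset.mem_range.1 hk
      omega
    | succ N hN ih =>
      rw [Finset.sum_range_succ, ih, if_pos hN, ← ENNReal.ofReal_add (sub_nonneg.2 (hβ hN))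
        (sub_nonneg.2 (hβ N.le_succ))]
      congr 1
      ring
  refine tendsto_nhds_unique (ENNReal.tendsto_nat_tsum _) ?_
  have h1 : Tendsto (fun N => ENNReal.ofReal (β n - β N)) atTop (𝓝 (ENNReal.ofReal (β n - 0))) :=
    ENNReal.tendsto_ofReal (h0.const_sub _)
  rw [sub_zero] at h1
  refine h1.congr' ?_
  filter_upwards [eventually_ge_atTop n] with N hN using (hs N hN).symm

/-- The second difference of a sequence. -/
def secondDiff (α : ℕ → ℝ) (k : ℕ) : ℝ := α k - 2 * α (k + 1) + α (k + 2)

/-- A convex null sequence is a mixture of the triangular sequences `n ↦ (k + 1 - n)₊`. -/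
theorem ofReal_eq_tsum_secondDiff {α : ℕ → ℝ} (hanti : Antitone α)
    (hconv : ∀ k, 0 ≤ secondDiff α k) (h0 : Tendsto α atTop (𝓝 0)) (n : ℕ) :
    ENNReal.ofReal (α n) =
      ∑' k, ((k + 1 - n : ℕ) : ℝ≥0∞) * ENNReal.ofReal (secondDiff α k) := by
  have hδ : Antitone fun j => α j - α (j + 1) := by
    refine antitone_nat_of_succ_le fun k => ?_
    have := hconv k
    simp only [secondDiff] at this
    linarith
  have hδ0 : Tendsto (fun j => α j - α (j + 1)) atTop (𝓝 0) := by
    simpa using h0.sub ((tendsto_add_atTop_iff_nat 1).2 h0)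
  have h2 : ∀ k, α k - α (k + 1) - (α (k + 1) - α (k + 1 + 1)) = secondDiff α k := fun k => by
    rw [secondDiff]; ring
  -- Telescoping is used twice: second differences sum to first differences, and these sum to α n.
  have h3 := tsum_ite_sub_eq hδ hδ0
  simp only [h2] at h3
  rw [← tsum_ite_sub_eq hanti h0 n]
  simp_rw [← h3]
  -- The sum runs over n ≤ j ≤ k. For fixed k there are k + 1 - n values of j, and truncated
  -- subtraction gives 0 when k < n.
  calc _ = ∑' j, ∑' k, (if n ≤ j then (if j ≤ k then ENNReal.ofReal (secondDiff α k) else 0)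
        else 0) := by
        refine tsum_congr fun j => ?_
        split_ifs <;> simp
    _ = ∑' k, ∑' j, (if n ≤ j then (if j ≤ k then ENNReal.ofReal (secondDiff α k) else 0)
        else 0) := ENNReal.tsum_comm
    _ = _ := by
        refine tsum_congr fun k => ?_
        rw [tsum_eq_sum (s := Finset.Icc n k)]
        · rw [Finset.sum_congr rfl (g := fun _ => ENNReal.ofReal (secondDiff α k)),
            Finset.sum_const, Nat.card_Icc, nsmul_eq_mul]
          intro j hj
          rw [Finset.mem_Icc] at hj
          rw [if_pos hj.1, if_pos hj.2]
        · intro j hj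
          rw [Finset.mem_Icc] at hj
          split_ifs with h5 h6
          · exact absurd ⟨h5, h6⟩ hj
          · rfl
          · rfl

theorem hasSum_secondDiff {α : ℕ → ℝ} (hpos : ∀ n, 0 < α n) (hanti : Antitone α)
    (hconv : ∀ k, 0 ≤ secondDiff α k) (h0 : Tendsto α atTop (𝓝 0)) (n : ℕ) :
    HasSum (fun k => ((k + 1 - n : ℕ) : ℝ) * secondDiff α k) (α n) := by
  have h := ofReal_eq_tsum_secondDiff hanti hconv h0 n
  have h1 : ∀ k, ((k + 1 - n : ℕ) : ℝ≥0∞) * ENNReal.ofReal (secondDiff α k) =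
      ENNReal.ofReal (((k + 1 - n : ℕ) : ℝ) * secondDiff α k) := fun k => by
    rw [ENNReal.ofReal_mul (Nat.cast_nonneg _), ENNReal.ofReal_natCast]
  simp_rw [h1] at h
  have hnn : ∀ k, 0 ≤ ((k + 1 - n : ℕ) : ℝ) * secondDiff α k := fun k =>
    mul_nonneg (Nat.cast_nonneg _) (hconv k)
  have hs : Summable fun k => ((k + 1 - n : ℕ) : ℝ) * secondDiff α k := by
    have h2 := ENNReal.summable_toReal (h ▸ ENNReal.ofReal_ne_top :
      ∑' k, ENNReal.ofReal (((k + 1 - n : ℕ) : ℝ) * secondDiff α k) ≠ ∞)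
    simpa only [ENNReal.toReal_ofReal (hnn _)] using h2
  rw [← ENNReal.ofReal_tsum_of_nonneg hnn hs] at h
  rw [(ENNReal.ofReal_eq_ofReal_iff (hpos n).le (tsum_nonneg hnn)).1 h]
  exact hs.hasSum

/-! ### Fejér sums: sup bound and Lipschitz bound. -/

/-- The unnormalized Fejér mean `∑ (k + 1 - n) a_n z ^ n` over `n ≤ k`. -/
def fejerSum (a : ℕ → ℂ) (k : ℕ) (z : ℂ) : ℂ :=
  ∑ n ∈ Finset.range (k + 1), ((k + 1 - n : ℕ) : ℂ) * a n * z ^ n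

theorem continuous_fejerSum (a : ℕ → ℂ) (k : ℕ) : Continuous (fejerSum a k) := by
  unfold fejerSum
  fun_prop

theorem differentiable_fejerSum (a : ℕ → ℂ) (k : ℕ) : Differentiable ℂ (fejerSum a k) := by
  unfold fejerSum
  fun_prop

/-- The unnormalized Fejér kernel. -/
def fejerKernel (k : ℕ) (ζ : ℂ) : ℂ :=
  (∑ i ∈ Finset.range (k + 1), conj ζ ^ i) * ∑ j ∈ Finset.range (k + 1), ζ ^ j

theorem continuous_fejerKernel (k : ℕ) : Continuous (fejerKernel k) := by
  unfold fejerKernel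
  fun_prop

theorem fejerKernel_eq_norm (k : ℕ) (ζ : ℂ) : fejerKernel k ζ = (‖fejerKernel k ζ‖ : ℂ) := by
  have h : fejerKernel k ζ = ((‖∑ j ∈ Finset.range (k + 1), ζ ^ j‖ ^ 2 : ℝ) : ℂ) := by
    rw [fejerKernel, Complex.ofReal_pow, ← Complex.conj_mul']
    simp
  rw [h, Complex.norm_real, Real.norm_of_nonneg (sq_nonneg _)]

theorem integral_fejerKernel_mul_pow (k n : ℕ) :
    ∫ ζ, fejerKernel k ζ * ζ ^ n ∂arcMeasure = ((k + 1 - n : ℕ) : ℂ) := by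
  have h : ∀ ζ, fejerKernel k ζ * ζ ^ n = ∑ j ∈ Finset.range (k + 1),
      ∑ i ∈ Finset.range (k + 1), conj ζ ^ i * ζ ^ (j + n) := by
    intro ζ
    rw [fejerKernel, Finset.sum_mul_sum, Finset.sum_comm, Finset.sum_mul]
    refine Finset.sum_congr rfl fun j _ => ?_
    rw [Finset.sum_mul]
    refine Finset.sum_congr rfl fun i _ => ?_
    ring
  simp_rw [h]
  rw [integral_finsetSum _ fun j _ => integrable_of_continuousOn (by fun_prop)]
  have h1 : ∀ j, ∫ ζ, ∑ i ∈ Finset.range (k + 1), conj ζ ^ i * ζ ^ (j + n) ∂arcMeasure =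
      if j + n < k + 1 then 1 else 0 := by
    intro j
    rw [integral_finsetSum _ fun i _ => integrable_of_continuousOn (by fun_prop)]
    simp_rw [integral_conj_pow_mul_pow]
    simp
  simp_rw [h1]
  rw [Finset.sum_boole]
  congr 1
  have h2 : Finset.filter (fun j => j + n < k + 1) (Finset.range (k + 1)) =
      Finset.range (k + 1 - n) := by
    ext j
    simp only [Finset.mem_filter, Finset.mem_range]
    omega
  rw [h2, Finset.card_range]

/-- In the disc the sum is ∫ K(ζ) f(zζ) dm(ζ) with the Fejér kernel K ≥ 0 of mass k + 1. Continuity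
gives the closed disc. -/
theorem norm_fejerSum_le {f : ℂ → ℂ} (hf : DifferentiableOn ℂ f disc) {M : ℝ}
    (hM : ∀ z, ‖z‖ < 1 → ‖f z‖ ≤ M) (k : ℕ) {z : ℂ} (hz : ‖z‖ ≤ 1) :
    ‖fejerSum (taylorCoeff f) k z‖ ≤ (k + 1) * M := by
  have hopen : ∀ z : ℂ, ‖z‖ < 1 → ‖fejerSum (taylorCoeff f) k z‖ ≤ (k + 1) * M := by
    intro z hz
    have h := hasSum_integral_mul_dilation hf hz (continuous_fejerKernel k).continuousOn
    simp_rw [integral_fejerKernel_mul_pow] at h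
    have h1 : fejerSum (taylorCoeff f) k z = ∫ ζ, fejerKernel k ζ * f (z * ζ) ∂arcMeasure := by
      rw [← h.tsum_eq, tsum_eq_sum (s := Finset.range (k + 1))]
      · exact Finset.sum_congr rfl fun n _ => by ring
      · intro n hn
        have : k + 1 - n = 0 := by simp only [Finset.mem_range] at hn; omega
        rw [this]
        simp
    have h2 : ∫ ζ, ‖fejerKernel k ζ‖ ∂arcMeasure = k + 1 := by
      have h3 := integral_fejerKernel_mul_pow k 0
      simp only [pow_zero, mul_one, tsub_zero] at h3
      rw [integral_congr_ae (Eventually.of_forall (fejerKernel_eq_norm k)),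
        integral_complex_ofReal] at h3
      exact_mod_cast h3
    have hint : Integrable (fun ζ => ‖fejerKernel k ζ‖) arcMeasure :=
      integrable_of_continuousOn (continuous_fejerKernel k).norm.continuousOn
    rw [h1, ← h2, ← integral_mul_const]
    refine norm_integral_le_of_norm_le (hint.mul_const M) ?_
    filter_upwards [ae_norm_eq_one] with ζ hζ
    rw [norm_mul]
    gcongr
    exact hM _ (by rwa [norm_mul, hζ, mul_one])
  have ht : Tendsto (fun r : ℝ => ‖fejerSum (taylorCoeff f) k (r * z)‖) (𝓝[<] 1)
      (𝓝 ‖fejerSum (taylorCoeff f) k z‖) := by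
    have h : Continuous fun r : ℝ => ‖fejerSum (taylorCoeff f) k (r * z)‖ :=
      ((continuous_fejerSum _ k).comp (by fun_prop)).norm
    simpa using (h.tendsto 1).mono_left nhdsWithin_le_nhds
  refine le_of_tendsto ht ?_
  filter_upwards [Ioo_mem_nhdsLT (show (0 : ℝ) < 1 by norm_num)] with r hr
  exact hopen _ (norm_ofReal_mul_lt_one hr hz)

theorem norm_taylorCoeff_le {f : ℂ → ℂ} (hf : DifferentiableOn ℂ f disc) {M : ℝ}
    (hM : ∀ z, ‖z‖ < 1 → ‖f z‖ ≤ M) (n : ℕ) : ‖taylorCoeff f n‖ ≤ M := by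
  have ht : Tendsto (fun r : ℝ => ‖taylorCoeff f n * (r : ℂ) ^ n‖) (𝓝[<] 1)
      (𝓝 ‖taylorCoeff f n‖) := by
    have h : Continuous fun r : ℝ => ‖taylorCoeff f n * (r : ℂ) ^ n‖ := by fun_prop
    simpa using (h.tendsto 1).mono_left nhdsWithin_le_nhds
  refine le_of_tendsto ht ?_
  filter_upwards [Ioo_mem_nhdsLT (show (0 : ℝ) < 1 by norm_num)] with r hr
  have hr1 : ‖(r : ℂ)‖ < 1 := by simpa using norm_ofReal_mul_lt_one hr (z := 1) (by simp)
  rw [← integral_conj_pow_mul_dilation hf hr1]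
  refine (norm_integral_le_of_norm_le (integrable_const M) ?_).trans_eq (by simp)
  filter_upwards [ae_norm_eq_one] with ζ hζ
  rw [norm_mul, norm_pow, RCLike.norm_conj, hζ, one_pow, one_mul]
  exact hM _ (norm_ofReal_mul_lt_one hr hζ.le)

theorem norm_pow_sub_pow_le_mul {ζ η : ℂ} (hζ : ‖ζ‖ ≤ 1) (hη : ‖η‖ ≤ 1) (n : ℕ) :
    ‖ζ ^ n - η ^ n‖ ≤ n * ‖ζ - η‖ := by
  induction n with
  | zero => simp
  | succ n ih =>
    have h : ζ ^ (n + 1) - η ^ (n + 1) = ζ ^ n * (ζ - η) + (ζ ^ n - η ^ n) * η := by ring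
    have h1 : ‖ζ ^ n‖ ≤ 1 := by rw [norm_pow]; exact pow_le_one₀ (norm_nonneg _) hζ
    rw [h]
    refine (norm_add_le _ _).trans ?_
    rw [norm_mul, norm_mul]
    push_cast
    nlinarith [norm_nonneg (ζ - η), norm_nonneg (ζ ^ n - η ^ n)]

theorem norm_fejerSum_sub_le {a : ℕ → ℂ} {M : ℝ} (ha : ∀ n, ‖a n‖ ≤ M) (k : ℕ) {ζ η : ℂ}
    (hζ : ‖ζ‖ ≤ 1) (hη : ‖η‖ ≤ 1) :
    ‖fejerSum a k ζ - fejerSum a k η‖ ≤ (k + 1) * M * (k ^ 2 * ‖ζ - η‖) := by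
  have hM : 0 ≤ M := (norm_nonneg _).trans (ha 0)
  -- The constant terms cancel; k terms with exponents at most k remain, whence k².
  rw [fejerSum, fejerSum, ← Finset.sum_sub_distrib, Finset.sum_range_succ']
  simp only [pow_zero, sub_self, add_zero]
  refine (norm_sum_le_of_le _ (f := fun n => _) (n := fun _ => (k + 1) * M * (k * ‖ζ - η‖))
    fun n hn => ?_).trans_eq ?_
  · have hn : n + 1 ≤ k := Finset.mem_range.1 hn
    rw [← mul_sub, norm_mul, norm_mul, Complex.norm_natCast]
    have h1 : ((k + 1 - (n + 1) : ℕ) : ℝ) ≤ k + 1 := by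
      have : k + 1 - (n + 1) ≤ k + 1 := Nat.sub_le _ _
      exact_mod_cast this
    have h2 : ‖ζ ^ (n + 1) - η ^ (n + 1)‖ ≤ k * ‖ζ - η‖ :=
      (norm_pow_sub_pow_le_mul hζ hη _).trans (by gcongr)
    gcongr
    exact ha _
  · rw [Finset.sum_const, Finset.card_range, nsmul_eq_mul]
    ring

/-! ### Logarithmic estimates. -/

/-- Layer cake: levels t ≤ 1 contribute at most 1, levels above N nothing, and for 1 < t ≤ N the
superlevel set lies in a ball of radius 2/t, of measure at most 1/t. -/
theorem lintegral_min_inv_norm_sub_le {η : ℂ} (hη : ‖η‖ = 1) {N : ℝ} (hN : 1 ≤ N) :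
    ∫⁻ ζ, ENNReal.ofReal (min N (2 / ‖ζ - η‖)) ∂arcMeasure ≤
      ENNReal.ofReal (1 + Real.log N) := by
  have hm : Measurable fun ζ : ℂ => min N (2 / ‖ζ - η‖) := by fun_prop
  rw [lintegral_eq_lintegral_meas_le _ (Eventually.of_forall fun ζ => by positivity)
    hm.aemeasurable]
  have hsub : Ioi (0 : ℝ) ⊆ Ioc 0 1 ∪ (Ioc 1 N ∪ Ioi N) := by
    intro t ht
    have ht : 0 < t := ht
    rcases le_or_gt t 1 with h | h
    · exact Or.inl ⟨ht, h⟩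
    · rcases le_or_gt t N with h' | h'
      · exact Or.inr (Or.inl ⟨h, h'⟩)
      · exact Or.inr (Or.inr h')
  refine (lintegral_mono_set hsub).trans ((lintegral_union_le _ _ _).trans ?_)
  rw [ENNReal.ofReal_add zero_le_one (Real.log_nonneg hN)]
  refine add_le_add ?_ ((lintegral_union_le _ _ _).trans ?_)
  · calc _ ≤ ∫⁻ _ in Ioc (0 : ℝ) 1, 1 := lintegral_mono fun t => prob_le_one
      _ = _ := by simp
  · have h1 : ∫⁻ t in Ioi N, arcMeasure {ζ | t ≤ min N (2 / ‖ζ - η‖)} = 0 := by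
      rw [setLIntegral_congr_fun (g := fun _ => 0) measurableSet_Ioi, lintegral_zero]
      intro t ht
      have : {ζ : ℂ | t ≤ min N (2 / ‖ζ - η‖)} = ∅ := by
        ext ζ
        simp only [mem_ofPred_eq, mem_empty_iff_false, iff_false, not_le]
        exact (min_le_left _ _).trans_lt ht
      simp only [this, measure_empty]
    rw [h1, add_zero]
    calc _ ≤ ∫⁻ t in Ioc 1 N, ENNReal.ofReal t⁻¹ := by
          refine setLIntegral_mono_ae' measurableSet_Ioc (Eventually.of_forall fun t ht => ?_)
          have ht0 : 0 < t := one_pos.trans ht.1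
          refine (measure_mono (t := Metric.closedBall η (2 / t)) fun ζ hζ => ?_).trans
            ((arcMeasure_closedBall_le hη _).trans (ENNReal.ofReal_le_ofReal ?_))
          · have h2 : t ≤ 2 / ‖ζ - η‖ := (show t ≤ min N (2 / ‖ζ - η‖) from hζ).trans
              (min_le_right _ _)
            rw [Metric.mem_closedBall, dist_eq_norm]
            rcases (norm_nonneg (ζ - η)).eq_or_lt with h3 | h3
            · rw [← h3]; positivity
            · rw [le_div_iff₀ h3] at h2
              rw [le_div_iff₀ ht0]
              linarith
          · exact le_of_eq (by field_simp)
      _ = ENNReal.ofReal (∫ t in Ioc 1 N, t⁻¹) := by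
          rw [ofReal_integral_eq_lintegral_ofReal]
          · have : IntervalIntegrable (fun t : ℝ => t⁻¹) volume 1 N :=
              intervalIntegral.intervalIntegrable_inv (fun t ht => by
                rw [uIcc_of_le hN] at ht; linarith [ht.1]) continuousOn_id
            exact (intervalIntegrable_iff_integrableOn_Ioc_of_le hN).1 this
          · exact (ae_restrict_mem measurableSet_Ioc).mono fun t ht =>
              inv_nonneg.2 (one_pos.trans ht.1).le
      _ ≤ _ := by
          rw [← intervalIntegral.integral_of_le hN, integral_inv_of_pos one_pos (one_pos.trans_le hN),
            div_one]

theorem lintegral_min_sq_inv_norm_sub_le {η : ℂ} (hη : ‖η‖ = 1) (k : ℕ) :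
    ∫⁻ ζ, ENNReal.ofReal (min ((k : ℝ) ^ 2) (2 / ‖ζ - η‖)) ∂arcMeasure ≤
      ENNReal.ofReal (1 + 2 * Real.log k) := by
  -- For k = 0 the integrand vanishes, and `Real.log 0 = 0` keeps the right side nonnegative.
  rcases Nat.eq_zero_or_pos k with rfl | hk
  · have h : ∀ ζ : ℂ, min (((0 : ℕ) : ℝ) ^ 2) (2 / ‖ζ - η‖) = 0 := fun ζ => by
      rw [min_eq_left]
      · simp
      · simp only [Nat.cast_zero, ne_eq, OfNat.ofNat_ne_zero, not_false_eq_true, zero_pow]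
        positivity
    simp_rw [h]
    simp
  · have h1 : (1 : ℝ) ≤ (k : ℝ) ^ 2 := one_le_pow₀ (by exact_mod_cast hk)
    refine (lintegral_min_inv_norm_sub_le hη h1).trans_eq ?_
    rw [Real.log_pow]
    norm_num

/-- The sum S equals (k + 2) H_{k+1} - (k + 1), with H_{k+1} ≥ log k, so (k + 1) log k ≤ S + (k +
1). The term n = 0 alone gives S ≥ k + 1. Together they bound the left side by 6 S already. -/
theorem mul_log_le_sum (k : ℕ) : ((k : ℝ) + 1) * (2 + 2 * Real.log k) ≤
    12 * ∑ n ∈ Finset.range (k + 1), ((k + 1 - n : ℕ) : ℝ) / ((n : ℝ) + 1) := by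
  set S := ∑ n ∈ Finset.range (k + 1), ((k + 1 - n : ℕ) : ℝ) / ((n : ℝ) + 1) with hS
  have h1 : (k : ℝ) + 1 ≤ S := by
    have h := Finset.single_le_sum (f := fun n : ℕ => ((k + 1 - n : ℕ) : ℝ) / ((n : ℝ) + 1))
      (fun n _ => by positivity) (Finset.mem_range.2 k.succ_pos)
    simpa using h
  have h2 : S = (k + 2) * (harmonic (k + 1) : ℝ) - (k + 1) := by
    have h3 : ∀ n ∈ Finset.range (k + 1), ((k + 1 - n : ℕ) : ℝ) / ((n : ℝ) + 1) =
        (k + 2) * ((n : ℝ) + 1)⁻¹ - 1 := by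
      intro n hn
      have hn' : n ≤ k + 1 := (Finset.mem_range.1 hn).le
      rw [Nat.cast_sub hn']
      push_cast
      field_simp
      ring
    rw [hS, Finset.sum_congr rfl h3, Finset.sum_sub_distrib, ← Finset.mul_sum, harmonic]
    push_cast
    simp
  have h3 := log_add_one_le_harmonic (k + 1)
  have h4 : Real.log k ≤ Real.log ((k + 1 : ℕ) + 1 : ℝ) := by
    rcases Nat.eq_zero_or_pos k with rfl | hk
    · simp only [Nat.cast_zero, Real.log_zero]
      exact Real.log_nonneg (by norm_num)
    · exact Real.log_le_log (by exact_mod_cast hk) (by push_cast; linarith)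
  have h5 : 0 ≤ Real.log k := Real.log_natCast_nonneg k
  have h6 : ((k : ℝ) + 1) * Real.log k ≤ S + (k + 1) := by
    rw [h2]
    have : ((k : ℝ) + 1) * Real.log k ≤ (k + 2) * (harmonic (k + 1) : ℝ) := by
      have hk0 : (0 : ℝ) ≤ k := Nat.cast_nonneg k
      have h7 : Real.log k ≤ (harmonic (k + 1) : ℝ) := h4.trans (by exact_mod_cast h3)
      gcongr
      linarith
    linarith
  nlinarith

/-! ### The multiplier estimate in 𝔑. -/

/-- The series of Fejér sums with weights `c`. -/
def fejerSeries (a : ℕ → ℂ) (c : ℕ → ℝ) (z : ℂ) : ℂ := ∑' k, (c k : ℂ) * fejerSum a k z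

/-- Exchange of an absolutely convergent double series; its row sums are at most |f̂(n) z^n| α_0. -/
theorem coeffMul_eq_fejerSeries {f : ℂ → ℂ} (hf : DifferentiableOn ℂ f disc) {α : ℕ → ℝ}
    {c : ℕ → ℝ} (hc : ∀ k, 0 ≤ c k)
    (hα : ∀ n, HasSum (fun k => ((k + 1 - n : ℕ) : ℝ) * c k) (α n)) (hanti : Antitone α) {z : ℂ}
    (hz : ‖z‖ < 1) : coeffMul f α z = fejerSeries (taylorCoeff f) c z := by
  have hα0 : ∀ n, 0 ≤ α n := fun n =>
    (hα n).nonneg fun k => mul_nonneg (Nat.cast_nonneg _) (hc k)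
  set F : ℕ → ℕ → ℂ := fun n k => taylorCoeff f n * z ^ n * ((((k + 1 - n : ℕ) : ℝ) * c k : ℝ) : ℂ)
    with hF
  have hnorm : ∀ n k, ‖F n k‖ = ‖taylorCoeff f n * z ^ n‖ * (((k + 1 - n : ℕ) : ℝ) * c k) := by
    intro n k
    rw [hF, norm_mul, Complex.norm_real, Real.norm_of_nonneg
      (mul_nonneg (Nat.cast_nonneg _) (hc k))]
  have hrow : ∀ n, HasSum (fun k => ‖F n k‖) (‖taylorCoeff f n * z ^ n‖ * α n) := by
    intro n
    simp_rw [hnorm]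
    exact (hα n).mul_left _
  have hsum : Summable (Function.uncurry F) := by
    refine Summable.of_norm ((summable_prod_of_nonneg fun x => norm_nonneg _).2
      ⟨fun n => (hrow n).summable, ?_⟩)
    have h1 : ∀ n, ∑' k, ‖Function.uncurry F (n, k)‖ = ‖taylorCoeff f n * z ^ n‖ * α n :=
      fun n => (hrow n).tsum_eq
    simp_rw [h1]
    refine Summable.of_nonneg_of_le (fun n => mul_nonneg (norm_nonneg _) (hα0 n)) (fun n => ?_)
      ((hasSum_taylorCoeff hf hz).summable.norm.mul_right (α 0))
    gcongr
    exact hanti n.zero_le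
  have hl : coeffMul f α z = ∑' n, ∑' k, F n k := by
    refine tsum_congr fun n => ?_
    rw [hF, tsum_mul_left, ← Complex.ofReal_tsum, (hα n).tsum_eq]
    ring
  rw [hl, ← hsum.tsum_comm, fejerSeries]
  refine tsum_congr fun k => ?_
  rw [tsum_eq_sum (s := Finset.range (k + 1)), fejerSum, Finset.mul_sum]
  · refine Finset.sum_congr rfl fun n _ => ?_
    rw [hF]
    push_cast
    ring
  · intro n hn
    have : k + 1 - n = 0 := by simp only [Finset.mem_range] at hn; omega
    simp [hF, this]

theorem norm_weight_mul_fejerSum_le {f : ℂ → ℂ} (hf : DifferentiableOn ℂ f disc) {M : ℝ}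
    (hM : ∀ z, ‖z‖ < 1 → ‖f z‖ ≤ M) {c : ℕ → ℝ} (hc : ∀ k, 0 ≤ c k) (k : ℕ) {z : ℂ}
    (hz : ‖z‖ ≤ 1) : ‖(c k : ℂ) * fejerSum (taylorCoeff f) k z‖ ≤ (k + 1) * c k * M := by
  rw [norm_mul, Complex.norm_real, Real.norm_of_nonneg (hc k)]
  calc _ ≤ c k * ((k + 1) * M) := by
        gcongr
        · exact hc k
        · exact norm_fejerSum_le hf hM k hz
    _ = _ := by ring

section

variable {f : ℂ → ℂ} {M : ℝ} {c : ℕ → ℝ}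

theorem summable_fejerSeries (hf : DifferentiableOn ℂ f disc) (hM : ∀ z, ‖z‖ < 1 → ‖f z‖ ≤ M)
    (hc : ∀ k, 0 ≤ c k) (hs : Summable fun k : ℕ => ((k : ℝ) + 1) * c k) {z : ℂ} (hz : ‖z‖ ≤ 1) :
    Summable fun k => (c k : ℂ) * fejerSum (taylorCoeff f) k z :=
  Summable.of_norm_bounded (hs.mul_right M) fun k => norm_weight_mul_fejerSum_le hf hM hc k hz

theorem continuousOn_fejerSeries (hf : DifferentiableOn ℂ f disc) (hM : ∀ z, ‖z‖ < 1 → ‖f z‖ ≤ M)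
    (hc : ∀ k, 0 ≤ c k) (hs : Summable fun k : ℕ => ((k : ℝ) + 1) * c k) :
    ContinuousOn (fejerSeries (taylorCoeff f) c) (Metric.closedBall 0 1) :=
  continuousOn_tsum (fun k => (continuous_const.mul (continuous_fejerSum _ k)).continuousOn)
    (hs.mul_right M) fun k _ hz => norm_weight_mul_fejerSum_le hf hM hc k (by simpa using hz)

theorem differentiableOn_fejerSeries (hf : DifferentiableOn ℂ f disc)
    (hM : ∀ z, ‖z‖ < 1 → ‖f z‖ ≤ M) (hc : ∀ k, 0 ≤ c k)
    (hs : Summable fun k : ℕ => ((k : ℝ) + 1) * c k) :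
    DifferentiableOn ℂ (fejerSeries (taylorCoeff f) c) disc :=
  Complex.differentiableOn_tsum_of_summable_norm (hs.mul_right M)
    (fun k => ((differentiable_fejerSum _ k).const_mul _).differentiableOn) isOpen_disc
    fun k _ hz => norm_weight_mul_fejerSum_le hf hM hc k (mem_disc.1 hz).le

theorem enorm_fejerSeries_le (hf : DifferentiableOn ℂ f disc) (hM : ∀ z, ‖z‖ < 1 → ‖f z‖ ≤ M)
    (hc : ∀ k, 0 ≤ c k) {z : ℂ} (hz : ‖z‖ ≤ 1) :
    ‖fejerSeries (taylorCoeff f) c z‖ₑ ≤ ∑' k : ℕ, ENNReal.ofReal (((k : ℝ) + 1) * c k * M) := by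
  refine enorm_tsum_le_tsum_enorm.trans (ENNReal.tsum_le_tsum fun k => ?_)
  rw [← ofReal_norm]
  exact ENNReal.ofReal_le_ofReal (norm_weight_mul_fejerSum_le hf hM hc k hz)

theorem enorm_weight_mul_sub_div_le (hf : DifferentiableOn ℂ f disc)
    (hM : ∀ z, ‖z‖ < 1 → ‖f z‖ ≤ M) (hc : ∀ k, 0 ≤ c k) (k : ℕ) {ζ η : ℂ} (hζ : ‖ζ‖ ≤ 1)
    (hη : ‖η‖ ≤ 1) :
    ‖(c k : ℂ) * fejerSum (taylorCoeff f) k ζ - (c k : ℂ) * fejerSum (taylorCoeff f) k η‖ₑ /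
      ‖ζ - η‖ₑ ≤ ENNReal.ofReal (((k : ℝ) + 1) * c k * M) *
        ENNReal.ofReal (min ((k : ℝ) ^ 2) (2 / ‖ζ - η‖)) := by
  have hM0 : 0 ≤ M := (norm_nonneg _).trans (hM 0 (by simp))
  -- On the diagonal the quotient is 0/0 = 0 in `ℝ≥0∞`.
  rcases eq_or_ne ζ η with rfl | hne
  · simp
  have h0 : 0 < ‖ζ - η‖ := norm_pos_iff.2 (sub_ne_zero.2 hne)
  have hck := hc k
  rw [← ofReal_norm, ← ofReal_norm, ← ENNReal.ofReal_div_of_pos h0,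
    ← ENNReal.ofReal_mul (by positivity)]
  refine ENNReal.ofReal_le_ofReal ?_
  rw [← mul_sub, norm_mul, Complex.norm_real, Real.norm_of_nonneg hck,
    mul_min_of_nonneg _ _ (by positivity), div_le_iff₀ h0, min_mul_of_nonneg _ _ h0.le]
  refine le_min ?_ ?_
  · have h1 := norm_fejerSum_sub_le (norm_taylorCoeff_le hf hM) k hζ hη
    calc _ ≤ c k * ((k + 1) * M * (k ^ 2 * ‖ζ - η‖)) := by gcongr
      _ = _ := by ring
  · have h1 : ‖fejerSum (taylorCoeff f) k ζ - fejerSum (taylorCoeff f) k η‖ ≤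
        (k + 1) * M + (k + 1) * M :=
      (norm_sub_le _ _).trans (add_le_add (norm_fejerSum_le hf hM k hζ)
        (norm_fejerSum_le hf hM k hη))
    calc _ ≤ c k * ((k + 1) * M + (k + 1) * M) := by gcongr
      _ = _ := by field_simp; ring

theorem lintegral_fejerSeries_sub_div_le (hf : DifferentiableOn ℂ f disc)
    (hM : ∀ z, ‖z‖ < 1 → ‖f z‖ ≤ M) (hc : ∀ k, 0 ≤ c k)
    (hs : Summable fun k : ℕ => ((k : ℝ) + 1) * c k) {η : ℂ} (hη : ‖η‖ = 1) :
    ∫⁻ ζ, ‖fejerSeries (taylorCoeff f) c ζ - fejerSeries (taylorCoeff f) c η‖ₑ / ‖ζ - η‖ₑ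
      ∂arcMeasure ≤ ∑' k : ℕ, ENNReal.ofReal (((k : ℝ) + 1) * c k * M) *
        ENNReal.ofReal (1 + 2 * Real.log k) := by
  calc _ ≤ ∫⁻ ζ, ∑' k : ℕ, ENNReal.ofReal (((k : ℝ) + 1) * c k * M) *
        ENNReal.ofReal (min ((k : ℝ) ^ 2) (2 / ‖ζ - η‖)) ∂arcMeasure := by
        refine lintegral_mono_ae ?_
        filter_upwards [ae_norm_eq_one] with ζ hζ
        rw [fejerSeries, fejerSeries, ← (summable_fejerSeries hf hM hc hs hζ.le).tsum_sub
          (summable_fejerSeries hf hM hc hs hη.le), div_eq_mul_inv]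
        refine (mul_le_mul' enorm_tsum_le_tsum_enorm le_rfl).trans ?_
        rw [← ENNReal.tsum_mul_right]
        exact ENNReal.tsum_le_tsum fun k =>
          enorm_weight_mul_sub_div_le hf hM hc k hζ.le hη.le
    _ = ∑' k : ℕ, ENNReal.ofReal (((k : ℝ) + 1) * c k * M) *
        ∫⁻ ζ, ENNReal.ofReal (min ((k : ℝ) ^ 2) (2 / ‖ζ - η‖)) ∂arcMeasure := by
        rw [lintegral_tsum fun k => Measurable.aemeasurable (by fun_prop)]
        exact tsum_congr fun k => lintegral_const_mul' _ _ ENNReal.ofReal_ne_top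
    _ ≤ _ := ENNReal.tsum_le_tsum fun k =>
        mul_le_mul' le_rfl (lintegral_min_sq_inv_norm_sub_le hη k)

/-- Applied with G the Fejér series, continuous on the closed disc; the values of f * α outside the
open disc play no role. -/
theorem boundaryValue_eq_of_continuousOn {g G : ℂ → ℂ} (hgG : ∀ z, ‖z‖ < 1 → g z = G z)
    (hG : ContinuousOn G (Metric.closedBall 0 1)) {ζ : ℂ} (hζ : ‖ζ‖ = 1) :
    boundaryValue g ζ = G ζ := by
  have h1 : Tendsto (fun r : ℝ => (r : ℂ) * ζ) (𝓝[<] 1) (𝓝[Metric.closedBall 0 1] ζ) := by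
    refine tendsto_nhdsWithin_iff.2 ⟨?_, ?_⟩
    · have h : Continuous fun r : ℝ => (r : ℂ) * ζ := by fun_prop
      simpa using (h.tendsto 1).mono_left nhdsWithin_le_nhds
    · filter_upwards [Ioo_mem_nhdsLT (show (0 : ℝ) < 1 by norm_num)] with r hr
      simpa using (norm_ofReal_mul_lt_one hr hζ.le).le
  refine (((hG ζ (by simp [hζ])).tendsto.comp h1).congr' ?_).limUnder_eq
  filter_upwards [Ioo_mem_nhdsLT (show (0 : ℝ) < 1 by norm_num)] with r hr
  exact (hgG _ (norm_ofReal_mul_lt_one hr hζ.le)).symm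

end

theorem lam_le_of_eq_fejerSeries {f g : ℂ → ℂ} (hf : DifferentiableOn ℂ f disc) {M : ℝ}
    (hM : ∀ z, ‖z‖ < 1 → ‖f z‖ ≤ M) {c : ℕ → ℝ} (hc : ∀ k, 0 ≤ c k)
    (hs : Summable fun k : ℕ => ((k : ℝ) + 1) * c k)
    (hg : ∀ z, ‖z‖ < 1 → g z = fejerSeries (taylorCoeff f) c z) :
    lam g ≤ ∑' k : ℕ, ENNReal.ofReal (((k : ℝ) + 1) * c k * M) *
      ENNReal.ofReal (1 + 2 * Real.log k) := by
  have hb : ∀ ζ : ℂ, ‖ζ‖ = 1 → boundaryValue g ζ = fejerSeries (taylorCoeff f) c ζ :=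
    fun ζ hζ => boundaryValue_eq_of_continuousOn hg (continuousOn_fejerSeries hf hM hc hs) hζ
  refine essSup_le_of_ae_le _ ?_
  filter_upwards [ae_norm_eq_one] with η hη
  refine le_trans (le_of_eq (lintegral_congr_ae ?_))
    (lintegral_fejerSeries_sub_div_le hf hM hc hs hη)
  filter_upwards [ae_norm_eq_one] with ζ hζ
  rw [hb ζ hζ, hb η hη]

/-- Inserting the mixture and exchanging sums, the weight c_k receives ∑_{n ≤ k} (k + 1 - n)/(n +
1), to which `mul_log_le_sum` applies. -/
theorem tsum_weight_le {α c : ℕ → ℝ} (hc : ∀ k, 0 ≤ c k)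
    (hα : ∀ n, ENNReal.ofReal (α n) = ∑' k, ((k + 1 - n : ℕ) : ℝ≥0∞) * ENNReal.ofReal (c k)) :
    ∑' k : ℕ, ENNReal.ofReal (((k : ℝ) + 1) * (2 + 2 * Real.log k) * c k) ≤
      12 * ∑' n : ℕ, ENNReal.ofReal (α n / ((n : ℝ) + 1)) := by
  have h1 : ∀ n : ℕ, ENNReal.ofReal (α n / ((n : ℝ) + 1)) =
      ∑' k, ENNReal.ofReal (((k + 1 - n : ℕ) : ℝ) / ((n : ℝ) + 1)) * ENNReal.ofReal (c k) := by
    intro n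
    have hn : (0 : ℝ) < (n : ℝ) + 1 := by positivity
    rw [ENNReal.ofReal_div_of_pos hn, hα n, div_eq_mul_inv, ← ENNReal.tsum_mul_right]
    refine tsum_congr fun k => ?_
    rw [ENNReal.ofReal_div_of_pos hn, ENNReal.ofReal_natCast, div_eq_mul_inv]
    ring
  simp_rw [h1]
  rw [ENNReal.tsum_comm, ← ENNReal.tsum_mul_left]
  refine ENNReal.tsum_le_tsum fun k => ?_
  rw [ENNReal.tsum_mul_right, ENNReal.ofReal_mul' (hc k), ← mul_assoc]
  refine mul_le_mul' ?_ le_rfl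
  refine (ENNReal.ofReal_le_ofReal (mul_log_le_sum k)).trans ?_
  rw [ENNReal.ofReal_mul (by norm_num), ENNReal.ofReal_ofNat,
    ENNReal.ofReal_sum_of_nonneg fun n _ => by positivity]
  exact mul_le_mul' le_rfl (ENNReal.sum_le_tsum _)

/-- The multiplier estimate in the class `𝔑`. -/
theorem coeffMul_mem_classN_and_normN_le {α : ℕ → ℝ} (hpos : ∀ n, 0 < α n) (hanti : Antitone α)
    (hconv : ∀ k, 0 ≤ secondDiff α k) (hsum : Summable fun n : ℕ => α n / ((n : ℝ) + 1))
    {f : ℂ → ℂ} (hf : f ∈ hardySpace ∞) :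
    coeffMul f α ∈ classN ∧ normN (coeffMul f α) ≤
      12 * hardyNorm ∞ f * ENNReal.ofReal (∑' n : ℕ, α n / ((n : ℝ) + 1)) := by
  have h0 := tendsto_zero_of_summable_div hpos hanti hsum
  set c := secondDiff α
  have hs := hasSum_secondDiff hpos hanti hconv h0
  set M := (hardyNorm ∞ f).toReal with hMdef
  have hM : ∀ z, ‖z‖ < 1 → ‖f z‖ ≤ M := fun z hz => by
    rw [← toReal_enorm]
    exact ENNReal.toReal_mono hf.2.ne (enorm_le_hardyNorm_top f hz)
  -- The mixture formula at n = 0: the sum is α 0.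
  have hs0 : Summable fun k : ℕ => ((k : ℝ) + 1) * c k := by
    simpa using (hs 0).summable
  have hg : ∀ z, ‖z‖ < 1 → coeffMul f α z = fejerSeries (taylorCoeff f) c z := fun z hz =>
    coeffMul_eq_fejerSeries hf.1 hconv hs hanti hz
  have hdiff : DifferentiableOn ℂ (coeffMul f α) disc :=
    (differentiableOn_fejerSeries hf.1 hM hconv hs0).congr fun z hz => hg z (mem_disc.1 hz)
  have hsup : hardyNorm ∞ (coeffMul f α) ≤
      ∑' k : ℕ, ENNReal.ofReal (((k : ℝ) + 1) * c k * M) := by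
    rw [hardyNorm_top]
    refine iSup₂_le fun z hz => ?_
    rw [hg z (mem_disc.1 hz)]
    exact enorm_fejerSeries_le hf.1 hM hconv (mem_disc.1 hz).le
  have hlam := lam_le_of_eq_fejerSeries hf.1 hM hconv hs0 hg
  have hnorm : normN (coeffMul f α) ≤
      12 * hardyNorm ∞ f * ENNReal.ofReal (∑' n : ℕ, α n / ((n : ℝ) + 1)) := by
    refine (add_le_add hsup hlam).trans ?_
    rw [← ENNReal.tsum_add, ENNReal.ofReal_tsum_of_nonneg
      (fun n => div_nonneg (hpos n).le (by positivity)) hsum]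
    -- The sup norm contributes 1 and Λ contributes 1 + 2 log k to the factor 2 + 2 log k.
    have h2 : ∀ k : ℕ, ENNReal.ofReal (((k : ℝ) + 1) * c k * M) +
        ENNReal.ofReal (((k : ℝ) + 1) * c k * M) * ENNReal.ofReal (1 + 2 * Real.log k) =
        hardyNorm ∞ f * ENNReal.ofReal (((k : ℝ) + 1) * (2 + 2 * Real.log k) * c k) := by
      intro k
      have hck : 0 ≤ c k := hconv k
      have hM0 : 0 ≤ M := ENNReal.toReal_nonneg
      have hl : 0 ≤ Real.log k := Real.log_natCast_nonneg k
      rw [← ENNReal.ofReal_mul (by positivity), ← ENNReal.ofReal_add (by positivity)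
        (by positivity), ← ENNReal.ofReal_toReal hf.2.ne, ← hMdef, ← ENNReal.ofReal_mul hM0]
      congr 1
      ring
    simp_rw [h2]
    rw [ENNReal.tsum_mul_left]
    calc _ ≤ hardyNorm ∞ f * (12 * ∑' n : ℕ, ENNReal.ofReal (α n / ((n : ℝ) + 1))) :=
          mul_le_mul' le_rfl (tsum_weight_le hconv (ofReal_eq_tsum_secondDiff hanti hconv h0))
      _ = _ := by ring
  have hlt : normN (coeffMul f α) < ∞ := hnorm.trans_lt
    (ENNReal.mul_lt_top (ENNReal.mul_lt_top (by norm_num) hf.2) ENNReal.ofReal_lt_top)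
  have hlt' := ENNReal.add_lt_top.1 hlt
  exact ⟨⟨⟨hdiff, hlt'.1⟩, hlt'.2⟩, hnorm⟩

end HardyToeplitz

end

open HardyToeplitz in
theorem theorem2 (α : ℕ → ℝ) (hpos : ∀ n, 0 < α n) (hanti : Antitone α)
    (hconc : ∀ n, 0 ≤ α n - 2 * α (n + 1) + α (n + 2))
    (hsum : Summable fun n : ℕ => α n / ((n : ℝ) + 1))
    (f : ℂ → ℂ) (hf : f ∈ hardySpace ∞) :
    coeffMul f α ∈ classN ∧
      (∀ p : ℝ≥0∞, p = 1 ∨ p = ∞ →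
        ToeplitzBounded p (coeffMul f α) ∧
          opNorm p (toeplitz (coeffMul f α)) ≤ normN (coeffMul f α)) ∧
      normN (coeffMul f α) ≤
        12 * hardyNorm ∞ f * ENNReal.ofReal (∑' n : ℕ, α n / ((n : ℝ) + 1)) := by
  obtain ⟨hmem, hnorm⟩ := coeffMul_mem_classN_and_normN_le hpos hanti hconc hsum hf
  exact ⟨hmem, fun p hp => ⟨toeplitzBounded hmem hp, opNorm_toeplitz_le hmem hp⟩, hnorm⟩
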